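/- For a prime $p$ and $q = p^m$ with $m \ge 1$, let $\mathbb{F}_q$ be the field with $q$ elements, $\mathrm{Tr}(x) = \sum_{i=0}^{m-1} x^{p^i} \in \mathbb{F}_p$ its absolute trace, $\psi(x) = \exp(2\pi i\,\mathrm{Tr}(x)/p)$, and, for an integer $n \ge 1$ and $a \in \mathbb{F}_q$, let $S_n(a) = \sum_{x \in \mathbb{F}_q} \psi(a x^n)$. There is a function $\eta : \mathbb{N} \to \mathbb{R}$ with $\eta(q) \to 0$ as $q \to \infty$ such that for every $C > 0$ there is a constant $K > 0$, depending only on $C$, with the following property. For every prime $p$, every $m \ge 1$ and every $n \mid q-1$, where $q = p^m$, such that $$\gcd\Big(n, \frac{q-1}{p^\nu-1}\Big) \le C\,\frac{n}{p^{\nu/2}} \qquad \text{for all } \nu \mid m \text{ with } 1 \le \nu < m,$$ one has $$\max_{a \in \mathbb{F}_q^*} |S_n(a)| \le K\Big(q^{91/128+\eta(q)}\, n^{73/128} + q^{92/128+\eta(q)}\, n^{71/128}\Big).$$ -/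

import Mathlib

open Filter Topology

noncomputable section

/-- The canonical additive character `ψ(x) = exp(2πi Tr(x) / p)` of a finite field `F` of
characteristic `p`, where `Tr : F → 𝔽_p` is the absolute trace. Here `ZMod.stdAddChar` is the
character `j ↦ exp(2πi j / p)` of `ZMod p`. -/
def canonicalChar (p : ℕ) [Fact p.Prime] (F : Type*) [Field F] [Algebra (ZMod p) F] :
    AddChar F ℂ :=
  (ZMod.stdAddChar (N := p)).compAddMonoidHom (Algebra.trace (ZMod p) F).toAddMonoidHom

/-- The Gauss sum `S_n(a) = ∑_{x ∈ F} ψ(a x ^ n)`. -/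
def gaussSumPow (p : ℕ) [Fact p.Prime] {F : Type*} [Field F] [Fintype F] [Algebra (ZMod p) F]
    (n : ℕ) (a : F) : ℂ :=
  ∑ x : F, canonicalChar p F (a * x ^ n)

/-- `gcd(n, (q - 1) / (p ^ ν - 1)) ≤ C n / p ^ (ν / 2)` for all `1 ≤ ν < m` with `ν ∣ m`, where
`q = p ^ m`. The divisions and subtractions of natural numbers are exact. -/
def SubfieldGcdCondition (C : ℝ) (p m n : ℕ) : Prop :=
  ∀ ν : ℕ, 1 ≤ ν → ν < m → ν ∣ m →
    (Nat.gcd n ((p ^ m - 1) / (p ^ ν - 1)) : ℝ) ≤ C * ((n : ℝ) / (p : ℝ) ^ ((ν : ℝ) / 2))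

end

/-! Let G be the group of nonzero n-th powers, of order t = (q-1)/n. Then S_n(a) = 1 + n ∑_{y ∈ G}
ψ(ay), and the modulus X of the inner sum does not change when a is multiplied by an element of G.
Comparing these t equal values with the second and fourth moments over all frequencies (Parseval)
gives X² ≤ q and t X⁴ ≤ q E, where E is the additive energy of G.

For n ≤ q^(49/100) the bound X² ≤ q suffices. For larger n one has t ≤ q^(51/100), and the core is
`energy_pow_le`: E^26 ≪ (log t + 1)^26 t^77. Some dyadic level set P of the number of
representations as a difference carries E up to a logarithm. Since P is symmetric and G-invariant,
"a - b ∈ P" defines a Cayley graph on G. Balog–Szemerédi–Gowers for this graph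
(`exists_subsets_card_sub_smul_le`) yields sets A' ⊆ A with |A - yA| ≤ T|A| for all y ∈ A'.

The sum-product dichotomy `exists_subfield_of_card_sub_smul_le` studies R = (A'-A')/(A'-A'). If |A'|
> 4096 T^5, then R is closed under r ↦ r - 1 and under multiplication by A', so it contains the ring
generated by A', a subfield K with |K| ≪ T^4 |A'|. If K is proper, the gcd condition gives |A'| ≤
C√|K|; if K is everything, t^9 ≤ q^5 is used. In every case |A'| ≪ T^5, which bounds E.

For n > q^(49/100) the resulting bound beats the second summand of the claim by a power of q. This
absorbs the logarithm, so η = 0 is admissible and the second summand alone suffices. -/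

/-! ### Plünnecke inequalities and the sum-product dichotomy -/

section SumProduct

open Finset
open scoped Pointwise Combinatorics.Additive

/-- A nonempty subset minimizing the ratio `#(U + B) / #U`. -/
theorem exists_subset_minimal_ratio {G : Type*} [DecidableEq G] [AddCommGroup G] {A : Finset G}
    (hA : A.Nonempty) (B : Finset G) :
    ∃ X ⊆ A, X.Nonempty ∧ (∀ X' ⊆ X, #(X + B) * #X' ≤ #(X' + B) * #X) ∧
      #(X + B) * #A ≤ #(A + B) * #X := by
  obtain ⟨X, hX, hmin⟩ := exists_min_image (A.powerset.erase ∅) (fun U ↦ (#(U + B) : ℚ) / #U)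
    ⟨A, mem_erase_of_ne_of_mem hA.ne_empty (mem_powerset_self _)⟩
  rw [mem_erase, mem_powerset, ← nonempty_iff_ne_empty] at hX
  have key : ∀ X' ⊆ A, #(X + B) * #X' ≤ #(X' + B) * #X := by
    intro X' hX'
    obtain rfl | hne := X'.eq_empty_or_nonempty
    · simp
    have h := hmin X' (mem_erase_of_ne_of_mem hne.ne_empty (mem_powerset.2 hX'))
    have h1 : (0 : ℚ) < #X := by exact_mod_cast hX.1.card_pos
    have h2 : (0 : ℚ) < #X' := by exact_mod_cast hne.card_pos
    rw [div_le_div_iff₀ h1 h2] at h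
    exact_mod_cast h
  exact ⟨X, hX.2, hX.1, fun X' h ↦ key X' (h.trans hX.2), key A subset_rfl⟩

/-- **Plünnecke's inequality** for the sum of a set with itself, relative to a subset. -/
theorem exists_subset_card_add_add_le {G : Type*} [DecidableEq G] [AddCommGroup G] {A : Finset G}
    (hA : A.Nonempty) (B : Finset G) :
    ∃ X ⊆ A, X.Nonempty ∧ #(X + B + B) * #A ^ 2 ≤ #(A + B) ^ 2 * #X := by
  obtain ⟨X, hXA, hX, hmin, hle⟩ := exists_subset_minimal_ratio hA B
  refine ⟨X, hXA, hX, ?_⟩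
  have h := pluennecke_petridis_inequality_add B hmin
  rw [add_comm B X] at h
  have hpos : 0 < #X := hX.card_pos
  refine le_of_mul_le_mul_right ?_ hpos
  calc #(X + B + B) * #A ^ 2 * #X = (#(X + B + B) * #X) * #A ^ 2 := by ring
    _ ≤ (#(X + B) * #(X + B)) * #A ^ 2 := by gcongr
    _ = (#(X + B) * #A) ^ 2 := by ring
    _ ≤ (#(A + B) * #X) ^ 2 := by gcongr
    _ = #(A + B) ^ 2 * #X * #X := by ring

/-- **Plünnecke's inequality** for two different summands. -/
theorem exists_subset_card_add_add_le_of_two {G : Type*} [DecidableEq G] [AddCommGroup G]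
    {A B C : Finset G} (hA : A.Nonempty) (hB : B.Nonempty) (hC : C.Nonempty) :
    ∃ X ⊆ A, X.Nonempty ∧ #(X + B + C) * #A ^ 2 ≤ 4 * (#(A + B) * #(A + C)) * #X := by
  set m := #(A + C) with hm
  set n := #(A + B) with hn
  have hmpos : 0 < m := (hA.add hC).card_pos
  have hnpos : 0 < n := (hA.add hB).card_pos
  have : NeZero m := ⟨hmpos.ne'⟩
  have : NeZero n := ⟨hnpos.ne'⟩
  -- Extra cyclic coordinates of orders m = #(A + C) and n = #(A + B) balance the two sumsets: both
  -- A₁ + B₁ and A₁ + C₁ have at most mn elements, so the union B₁ ∪ C₁ costs only a factor 2.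
  let A₁ : Finset (G × ZMod m × ZMod n) := A ×ˢ {(0, 0)}
  let B₁ : Finset (G × ZMod m × ZMod n) := B ×ˢ (univ ×ˢ {0})
  let C₁ : Finset (G × ZMod m × ZMod n) := C ×ˢ ({0} ×ˢ univ)
  have hA₁ : A₁.Nonempty := hA.product (singleton_nonempty _)
  obtain ⟨X₁, hX₁, hne, hle⟩ := exists_subset_card_add_add_le hA₁ (B₁ ∪ C₁)
  have hsum : #(A₁ + (B₁ ∪ C₁)) ≤ 2 * (n * m) := by
    rw [add_union]
    refine (card_union_le _ _).trans ?_
    have e1 : A₁ + B₁ ⊆ (A + B) ×ˢ ((univ : Finset (ZMod m)) ×ˢ ({0} : Finset (ZMod n))) := by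
      intro x hx
      obtain ⟨a, ha, b, hb, rfl⟩ := mem_add.1 hx
      simp only [A₁, B₁, mem_product, mem_singleton, Prod.ext_iff] at ha hb ⊢
      refine ⟨add_mem_add ha.1 hb.1, mem_univ _, ?_⟩
      simp [ha.2.2, hb.2.2]
    have e2 : A₁ + C₁ ⊆ (A + C) ×ˢ (({0} : Finset (ZMod m)) ×ˢ (univ : Finset (ZMod n))) := by
      intro x hx
      obtain ⟨a, ha, b, hb, rfl⟩ := mem_add.1 hx
      simp only [A₁, C₁, mem_product, mem_singleton, Prod.ext_iff] at ha hb ⊢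
      refine ⟨add_mem_add ha.1 hb.1, ?_, mem_univ _⟩
      simp [ha.2.1, hb.2.1]
    have c1 := card_le_card e1
    have c2 := card_le_card e2
    simp only [card_product, card_univ, ZMod.card, card_singleton] at c1 c2
    calc _ ≤ n * (m * 1) + m * (1 * n) := add_le_add c1 c2
      _ = 2 * (n * m) := by ring
  let X : Finset G := X₁.image Prod.fst
  have hX₁mem : ∀ x ∈ X₁, x = (x.1, 0, 0) := by
    intro x hx
    have := hX₁ hx
    simp only [A₁, mem_product, mem_singleton] at this
    exact Prod.ext rfl this.2
  have hXcard : #X = #X₁ := by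
    refine card_image_of_injOn fun x hx y hy hxy ↦ ?_
    rw [hX₁mem x hx, hX₁mem y hy]
    simpa using hxy
  have hcover : (X + B + C) ×ˢ ((univ : Finset (ZMod m)) ×ˢ (univ : Finset (ZMod n))) ⊆
      X₁ + (B₁ ∪ C₁) + (B₁ ∪ C₁) := by
    rintro ⟨z, u, v⟩ hz
    obtain ⟨w, hw, c, hc, rfl⟩ := mem_add.1 (mem_product.1 hz).1
    obtain ⟨x, hx, b, hb, rfl⟩ := mem_add.1 hw
    obtain ⟨x₁, hx₁, rfl⟩ := mem_image.1 hx
    refine mem_add.2 ⟨x₁ + (b, u, 0), add_mem_add hx₁ (mem_union_left _ ?_), (c, 0, v),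
      mem_union_right _ ?_, ?_⟩
    · simp [B₁, hb]
    · simp [C₁, hc]
    · rw [hX₁mem x₁ hx₁]; simp
  refine ⟨X, ?_, hne.image _, ?_⟩
  · intro x hx
    obtain ⟨x₁, hx₁, rfl⟩ := mem_image.1 hx
    exact (mem_product.1 (hX₁ hx₁)).1
  · have c3 := card_le_card hcover
    simp only [card_product, card_univ, ZMod.card] at c3
    have hAc : #A₁ = #A := by simp [A₁]
    rw [hAc] at hle
    rw [hXcard]
    refine le_of_mul_le_mul_right ?_ (Nat.mul_pos hmpos hnpos)
    calc #(X + B + C) * #A ^ 2 * (m * n) = (#(X + B + C) * (m * n)) * #A ^ 2 := by ring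
      _ ≤ #(X₁ + (B₁ ∪ C₁) + (B₁ ∪ C₁)) * #A ^ 2 := by gcongr
      _ ≤ #(A₁ + (B₁ ∪ C₁)) ^ 2 * #X₁ := hle
      _ ≤ (2 * (n * m)) ^ 2 * #X₁ := by gcongr
      _ = 4 * (n * m) * #X₁ * (m * n) := by ring

/-! ### Quotient sets of differences -/

variable {F : Type*} [Field F]

/-- The quotient set `(A - A) / (A - A)`. -/
def diffQuotients (A : Finset F) : Set F :=
  {r | ∃ a ∈ A, ∃ b ∈ A, ∃ c ∈ A, ∃ d ∈ A, c ≠ d ∧ r = (a - b) / (c - d)}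

theorem neg_mem_diffQuotients {A : Finset F} {r : F} (h : r ∈ diffQuotients A) :
    -r ∈ diffQuotients A := by
  obtain ⟨a, ha, b, hb, c, hc, d, hd, hne, rfl⟩ := h
  exact ⟨b, hb, a, ha, c, hc, d, hd, hne, by rw [← neg_div, neg_sub]⟩

theorem inv_mem_diffQuotients {A : Finset F} {r : F} (h : r ∈ diffQuotients A) :
    r⁻¹ ∈ diffQuotients A := by
  obtain ⟨a, ha, b, hb, c, hc, d, hd, hne, rfl⟩ := h
  -- Here the quotient is 0, and the convention `0⁻¹ = 0` keeps the inverse in the set.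
  obtain rfl | hab := eq_or_ne a b
  · exact ⟨a, ha, a, ha, c, hc, d, hd, hne, by simp⟩
  · exact ⟨c, hc, d, hd, a, ha, b, hb, hab, by rw [inv_div]⟩

variable [DecidableEq F]

theorem card_smul_finset_of_ne_zero {y : F} (hy : y ≠ 0) (A : Finset F) : #(y • A) = #A :=
  card_image_of_injective _ (mul_right_injective₀ hy)

/-- If `ξ` is not a quotient of differences of `A`, then `x + ξ a` determines `x, a ∈ A`. -/
theorem card_mul_card_le_of_notMem_diffQuotients {A X : Finset F} (hX : X ⊆ A) {ξ : F}
    (hξ : ξ ∉ diffQuotients A) : #X * #A ≤ #(X + ξ • A) := by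
  rw [← card_product]
  refine card_le_card_of_injOn (fun p ↦ p.1 + ξ * p.2) ?_ ?_
  · rintro ⟨x, a⟩ hp
    have hp := mem_product.1 hp
    exact add_mem_add hp.1 (mem_image.2 ⟨a, hp.2, rfl⟩)
  · rintro ⟨x, a⟩ hp ⟨x', a'⟩ hp' h
    have hp := mem_product.1 hp
    have hp' := mem_product.1 hp'
    simp only at h hp hp'
    by_cases haa : a' = a
    · subst haa
      simpa using h
    · refine absurd ⟨x, hX hp.1, x', hX hp'.1, a', hp'.2, a, hp.2, haa, ?_⟩ hξ
      rw [eq_div_iff (sub_ne_zero.2 haa)]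
      linear_combination -h

variable {A A' : Finset F} {T : ℝ}

/-- For r = (a-b)/(c-d), the dilate (c-d)(A + rA) lies in 2B - 2B, where B is the union of aA, bA,
cA, dA. Since |A - B| ≤ 4T|A|, Plünnecke–Ruzsa gives the factor (4T)^4 = 256 T^4. -/
theorem card_add_smul_le_of_mem_diffQuotients (hA : A.Nonempty)
    (hT : ∀ y ∈ A', (#(A - y • A) : ℝ) ≤ T * #A) {r : F} (hr : r ∈ diffQuotients A') :
    (#(A + r • A) : ℝ) ≤ 256 * T ^ 4 * #A := by
  obtain ⟨a, ha, b, hb, c, hc, d, hd, hne, rfl⟩ := hr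
  set B := a • A ∪ b • A ∪ c • A ∪ d • A with hBdef
  have hApos : (0 : ℝ) < #A := by exact_mod_cast hA.card_pos
  have hB : (#(A - B) : ℝ) ≤ 4 * T * #A := by
    have h : #(A - B) ≤ #(A - a • A) + #(A - b • A) + #(A - c • A) + #(A - d • A) := by
      rw [hBdef, sub_union, sub_union, sub_union]
      refine (card_union_le _ _).trans (Nat.add_le_add_right ((card_union_le _ _).trans
        (Nat.add_le_add_right (card_union_le _ _) _)) _)
    have h' : (#(A - B) : ℝ) ≤ #(A - a • A) + #(A - b • A) + #(A - c • A) + #(A - d • A) := by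
      exact_mod_cast h
    linarith [hT a ha, hT b hb, hT c hc, hT d hd]
  have hPR := pluennecke_ruzsa_inequality_nsmul_sub_nsmul_sub hA B 2 2
  have hPR' : (#(2 • B - 2 • B) : ℝ) ≤ (#(A - B) / #A : ℝ) ^ 4 * #A := by
    have := (NNRat.cast_le (K := ℝ)).2 hPR
    push_cast at this
    simpa using this
  have hsub : (c - d) • (A + ((a - b) / (c - d)) • A) ⊆ 2 • B - 2 • B := by
    intro z hz
    obtain ⟨w, hw, rfl⟩ := mem_smul_finset.1 hz
    obtain ⟨x, hx, w', hw', rfl⟩ := mem_add.1 hw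
    obtain ⟨x', hx', rfl⟩ := mem_smul_finset.1 hw'
    have hcd : c - d ≠ 0 := sub_ne_zero.2 hne
    rw [two_nsmul]
    refine mem_sub.2 ⟨c • x + a • x', add_mem_add ?_ ?_, d • x + b • x', add_mem_add ?_ ?_, ?_⟩
    · exact mem_union_left _ (mem_union_right _ (smul_mem_smul_finset hx))
    · exact mem_union_left _ (mem_union_left _ (mem_union_left _ (smul_mem_smul_finset hx')))
    · exact mem_union_right _ (smul_mem_smul_finset hx)
    · exact mem_union_left _ (mem_union_left _ (mem_union_right _ (smul_mem_smul_finset hx')))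
    · simp only [smul_eq_mul]
      field_simp
      ring
  have hcard := card_le_card hsub
  rw [card_smul_finset_of_ne_zero (sub_ne_zero.2 hne)] at hcard
  calc (#(A + ((a - b) / (c - d)) • A) : ℝ) ≤ #(2 • B - 2 • B) := by exact_mod_cast hcard
    _ ≤ (#(A - B) / #A : ℝ) ^ 4 * #A := hPR'
    _ ≤ (4 * T) ^ 4 * #A := by
        gcongr
        rwa [div_le_iff₀ hApos]
    _ = 256 * T ^ 4 * #A := by ring

theorem one_le_of_card_sub_smul_le (hA : A.Nonempty) (h1 : 1 ∈ A')
    (hT : ∀ y ∈ A', (#(A - y • A) : ℝ) ≤ T * #A) : 1 ≤ T := by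
  have h := hT 1 h1
  have hApos : (0 : ℝ) < #A := by exact_mod_cast hA.card_pos
  have h2 : (#A : ℝ) ≤ #(A - (1 : F) • A) := by
    exact_mod_cast card_le_card_sub_right (by simpa using hA)
  nlinarith

/-- If the quotient set is not closed under `r ↦ r - 1`, then `A'` is small. -/
theorem card_le_of_sub_one_notMem_diffQuotients (hA' : A' ⊆ A) (h1 : 1 ∈ A')
    (hcard : (#A : ℝ) ≤ 2 * #A') (hT : ∀ y ∈ A', (#(A - y • A) : ℝ) ≤ T * #A) {r : F}
    (hr : r ∈ diffQuotients A') (hr' : r - 1 ∉ diffQuotients A') :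
    (#A' : ℝ) ≤ 4096 * T ^ 5 := by
  have hne' : A'.Nonempty := ⟨1, h1⟩
  have hne : A.Nonempty := hne'.mono hA'
  have hT1 := one_le_of_card_sub_smul_le hne h1 hT
  obtain ⟨X, hX, hXne, hle⟩ := exists_subset_card_add_add_le_of_two hne'
    (hne'.image (r * ·) : (r • A').Nonempty) (hne'.neg)
  have hXpos : (0 : ℝ) < #X := by exact_mod_cast hXne.card_pos
  have hA'pos : (0 : ℝ) < #A' := by exact_mod_cast hne'.card_pos
  have b1 : (#(A' + r • A') : ℝ) ≤ 512 * T ^ 4 * #A' := by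
    have : #(A' + r • A') ≤ #(A + r • A) :=
      card_le_card (add_subset_add hA' (smul_finset_subset_smul_finset hA'))
    calc (#(A' + r • A') : ℝ) ≤ #(A + r • A) := by exact_mod_cast this
      _ ≤ 256 * T ^ 4 * #A := card_add_smul_le_of_mem_diffQuotients hne hT hr
      _ ≤ 256 * T ^ 4 * (2 * #A') := by gcongr
      _ = _ := by ring
  have b2 : (#(A' + -A') : ℝ) ≤ 2 * T * #A' := by
    have : #(A' + -A') ≤ #(A - (1 : F) • A) := by
      rw [one_smul, ← sub_eq_add_neg]
      exact card_le_card (sub_subset_sub hA' hA')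
    calc (#(A' + -A') : ℝ) ≤ #(A - (1 : F) • A) := by exact_mod_cast this
      _ ≤ T * #A := hT 1 h1
      _ ≤ T * (2 * #A') := by gcongr
      _ = _ := by ring
  -- The sums x + (r-1)a are pairwise distinct and lie in X + rA' - A', which Plünnecke controls.
  have b3 : #X * #A' ≤ #(X + r • A' + -A') := by
    refine (card_mul_card_le_of_notMem_diffQuotients hX hr').trans (card_le_card ?_)
    intro z hz
    obtain ⟨x, hx, w, hw, rfl⟩ := mem_add.1 hz
    obtain ⟨a, ha, rfl⟩ := mem_smul_finset.1 hw
    refine mem_add.2 ⟨x + r • a, add_mem_add hx (smul_mem_smul_finset ha), -a, neg_mem_neg ha, ?_⟩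
    simp only [smul_eq_mul]
    ring
  have hle' : (#X * #A' : ℝ) * (#A' : ℝ) ^ 2 ≤
      4 * ((#(A' + r • A') : ℝ) * #(A' + -A')) * #X := by
    calc (#X * #A' : ℝ) * (#A' : ℝ) ^ 2 ≤ (#(X + r • A' + -A') : ℝ) * (#A' : ℝ) ^ 2 := by
          gcongr; exact_mod_cast b3
      _ ≤ _ := by exact_mod_cast hle
  have hfin : (#A' : ℝ) * (#X * (#A' : ℝ) ^ 2) ≤ 4096 * T ^ 5 * (#X * (#A' : ℝ) ^ 2) := by
    calc (#A' : ℝ) * (#X * (#A' : ℝ) ^ 2) = (#X * #A' : ℝ) * (#A' : ℝ) ^ 2 := by ring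
      _ ≤ 4 * ((#(A' + r • A') : ℝ) * #(A' + -A')) * #X := hle'
      _ ≤ 4 * ((512 * T ^ 4 * #A') * (2 * T * #A')) * #X := by gcongr
      _ = 4096 * T ^ 5 * (#X * (#A' : ℝ) ^ 2) := by ring
  exact le_of_mul_le_mul_right hfin (by positivity)

/-- If the quotient set is not closed under multiplication by an element of `A'`, then `A'` is
small. -/
theorem card_le_of_mul_notMem_diffQuotients (hA' : A' ⊆ A) (h1 : 1 ∈ A')
    (h0 : 0 ∉ A') (hcard : (#A : ℝ) ≤ 2 * #A')
    (hT : ∀ y ∈ A', (#(A - y • A) : ℝ) ≤ T * #A) {r y : F}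
    (hr : r ∈ diffQuotients A') (hy : y ∈ A') (hr' : y * r ∉ diffQuotients A') :
    (#A' : ℝ) ≤ 4096 * T ^ 5 := by
  have hne' : A'.Nonempty := ⟨1, h1⟩
  have hne : A.Nonempty := hne'.mono hA'
  have hT1 := one_le_of_card_sub_smul_le hne h1 hT
  have hy0 : y ≠ 0 := fun h ↦ h0 (h ▸ hy)
  have hApos : (0 : ℝ) < #A := by exact_mod_cast hne.card_pos
  have hA'pos : (0 : ℝ) < #A' := by exact_mod_cast hne'.card_pos
  have b1 : #A' * #A' ≤ #(A + (y * r) • A) :=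
    (card_mul_card_le_of_notMem_diffQuotients subset_rfl hr').trans
      (card_le_card (add_subset_add hA' (smul_finset_subset_smul_finset hA')))
  -- The triangle inequality passes through yA, because yA + yrA is a dilate of A + rA.
  have b2 := ruzsa_triangle_inequality_add_sub_add A (y • A) ((y * r) • A)
  have b3 := card_add_smul_le_of_mem_diffQuotients hne hT hr
  have e1 : #(y • A - A) = #(A - y • A) := by rw [← card_neg, neg_sub]
  have e2 : #(y • A + (y * r) • A) = #(A + r • A) := by
    rw [mul_smul, ← smul_add, card_smul_finset_of_ne_zero hy0]
  rw [card_smul_finset_of_ne_zero hy0, e1, e2] at b2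
  have b4 : (#A : ℝ) * #(A + (y * r) • A) ≤ #(A - y • A) * #(A + r • A) := by exact_mod_cast b2
  have b5 : (#(A + (y * r) • A) : ℝ) ≤ 256 * T ^ 5 * #A := by
    refine le_of_mul_le_mul_left ?_ hApos
    calc (#A : ℝ) * #(A + (y * r) • A) ≤ #(A - y • A) * #(A + r • A) := b4
      _ ≤ (T * #A) * (256 * T ^ 4 * #A) := by gcongr; exact hT y hy
      _ = _ := by ring
  have b6 : (#A' : ℝ) * #A' ≤ 512 * T ^ 5 * #A' := by
    calc (#A' : ℝ) * #A' ≤ #(A + (y * r) • A) := by exact_mod_cast b1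
      _ ≤ 256 * T ^ 5 * #A := b5
      _ ≤ 256 * T ^ 5 * (2 * #A') := by gcongr
      _ = _ := by ring
  have b7 := le_of_mul_le_mul_right b6 hA'pos
  nlinarith [pow_pos (zero_lt_one.trans_le hT1) 5]

omit [DecidableEq F] in
/-- A quotient set that is closed under `r ↦ r - 1` and under multiplication by `A` is the ring
generated by `A`. -/
theorem ringClosure_subset_diffQuotients {A : Finset F} (h0 : 0 ∉ A)
    {a b : F} (ha : a ∈ A) (hb : b ∈ A) (hab : a ≠ b)
    (hsub : ∀ r ∈ diffQuotients A, r - 1 ∈ diffQuotients A)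
    (hmul : ∀ r ∈ diffQuotients A, ∀ y ∈ A, y * r ∈ diffQuotients A) :
    (Subring.closure (A : Set F) : Set F) ⊆ diffQuotients A := by
  have hzero : (0 : F) ∈ diffQuotients A := ⟨a, ha, a, ha, a, ha, b, hb, hab, by simp⟩
  have hmon : ∀ m ∈ Submonoid.closure (A : Set F),
      m ≠ 0 ∧ ∀ r ∈ diffQuotients A, m * r ∈ diffQuotients A := by
    intro m hm
    induction hm using Submonoid.closure_induction with
    | mem x hx => exact ⟨fun h ↦ h0 (h ▸ hx), fun r hr ↦ hmul r hr x hx⟩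
    | one => exact ⟨one_ne_zero, fun r hr ↦ by rwa [one_mul]⟩
    | mul x y _ _ hx hy =>
      exact ⟨mul_ne_zero hx.1 hy.1, fun r hr ↦ by rw [mul_assoc]; exact hx.2 _ (hy.2 r hr)⟩
  have hadd : ∀ v ∈ AddSubgroup.closure (Submonoid.closure (A : Set F) : Set F),
      ∀ r ∈ diffQuotients A, r + v ∈ diffQuotients A := by
    intro v hv
    induction hv using AddSubgroup.closure_induction with
    | mem m hm =>
      intro r hr
      obtain ⟨hm0, hmr⟩ := hmon m hm
      -- Stability under inversion turns multiplication by m into division by m. Adding m is then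
      -- conjugate to subtracting 1: r + m = -(m(m⁻¹(-r) - 1)).
      have hm' : m⁻¹ * (-r) ∈ diffQuotients A := by
        have := inv_mem_diffQuotients (hmr _ (inv_mem_diffQuotients (neg_mem_diffQuotients hr)))
        rwa [mul_inv, inv_inv] at this
      have h2 := neg_mem_diffQuotients (hmr _ (hsub _ hm'))
      have e : -(m * (m⁻¹ * (-r) - 1)) = r + m := by
        rw [mul_sub, mul_inv_cancel_left₀ hm0]; ring
      rwa [e] at h2
    | zero => intro r hr; rwa [add_zero]
    | add x y _ _ hx hy => intro r hr; rw [← add_assoc]; exact hy _ (hx r hr)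
    | neg x _ hx =>
      intro r hr
      have := neg_mem_diffQuotients (hx _ (neg_mem_diffQuotients hr))
      rwa [neg_add, neg_neg] at this
  intro x hx
  have := hadd x (Subring.mem_closure_iff.1 hx) 0 hzero
  rwa [zero_add] at this

/-- If `A + ξ A` is small for all `ξ` in a set `K`, then `K` is small. -/
theorem card_le_of_forall_card_add_smul_le {A K : Finset F} (hA : A.Nonempty) {M : ℝ}
    (hM : 0 < M) (hMA : 2 * M ≤ #A) (hK : ∀ ξ ∈ K, (#(A + ξ • A) : ℝ) ≤ M * #A)
    (h0 : 0 ∉ K) : (#K : ℝ) ≤ 2 * M * #A := by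
  have hApos : (0 : ℝ) < #A := by exact_mod_cast hA.card_pos
  -- Cauchy–Schwarz: a small sumset forces a large energy for each ξ, while the sum of the energies
  -- over ξ is limited by double counting.
  have lower : ∀ ξ ∈ K, (#A : ℝ) ^ 3 / M ≤ E[A, ξ • A] := by
    intro ξ hξ
    have h := le_card_add_mul_addEnergy A (ξ • A)
    rw [card_smul_finset_of_ne_zero (fun h ↦ h0 (h ▸ hξ))] at h
    have h' : (#A : ℝ) ^ 2 * (#A : ℝ) ^ 2 ≤ #(A + ξ • A) * E[A, ξ • A] := by exact_mod_cast h
    rw [div_le_iff₀ hM]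
    refine le_of_mul_le_mul_right ?_ hApos
    calc (#A : ℝ) ^ 3 * #A = (#A : ℝ) ^ 2 * (#A : ℝ) ^ 2 := by ring
      _ ≤ (#(A + ξ • A) : ℝ) * (E[A, ξ • A] : ℝ) := h'
      _ ≤ (M * #A) * (E[A, ξ • A] : ℝ) := by gcongr; exact hK ξ hξ
      _ = _ := by ring
  have upper : ∑ ξ ∈ K, E[A, ξ • A] ≤ #A ^ 4 + #K * #A ^ 2 := by
    let Q := (A ×ˢ A) ×ˢ (A ×ˢ A)
    have hE : ∀ ξ ∈ K, E[A, ξ • A] ≤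
        #{p ∈ Q | p.1.1 + ξ * p.2.1 = p.1.2 + ξ * p.2.2} := by
      intro ξ hξ
      have hξ0 : ξ ≠ 0 := fun h ↦ h0 (h ▸ hξ)
      refine card_le_card_of_injOn (fun p ↦ (p.1, (ξ⁻¹ * p.2.1, ξ⁻¹ * p.2.2))) ?_ ?_
      · rintro ⟨⟨x, x'⟩, y, y'⟩ hp
        simp only [coe_filter, Set.mem_ofPred_eq, mem_product] at hp
        obtain ⟨⟨⟨hx, hx'⟩, hy, hy'⟩, he⟩ := hp
        obtain ⟨y, hyA, rfl⟩ := mem_smul_finset.1 hy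
        obtain ⟨y', hyA', rfl⟩ := mem_smul_finset.1 hy'
        simp only [smul_eq_mul] at he
        simp [Q, hx, hx', hyA, hyA', inv_mul_cancel_left₀ hξ0, he]
      · rintro ⟨⟨x, x'⟩, y, y'⟩ _ ⟨⟨u, u'⟩, v, v'⟩ _ h
        simpa [hξ0] using h
    have hswap : ∑ ξ ∈ K, #{p ∈ Q | p.1.1 + ξ * p.2.1 = p.1.2 + ξ * p.2.2} =
        ∑ p ∈ Q, #{ξ ∈ K | p.1.1 + ξ * p.2.1 = p.1.2 + ξ * p.2.2} := by
      simp only [card_filter]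
      exact sum_comm
    -- A linear equation in ξ has at most one solution unless the quadruple is diagonal.
    have hp : ∀ p ∈ Q, #{ξ ∈ K | p.1.1 + ξ * p.2.1 = p.1.2 + ξ * p.2.2} ≤
        1 + if p.1.1 = p.1.2 ∧ p.2.1 = p.2.2 then #K else 0 := by
      rintro ⟨⟨x, x'⟩, y, y'⟩ _
      split_ifs with h
      · exact (card_filter_le _ _).trans (Nat.le_add_left _ _)
      · rw [add_zero, card_le_one]
        intro ξ hξ ξ' hξ'
        simp only [mem_filter] at hξ hξ' h
        have hyy : y - y' ≠ 0 := by
          intro hy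
          rw [sub_eq_zero] at hy
          exact h ⟨by simpa [hy] using hξ.2, hy⟩
        refine mul_right_cancel₀ hyy ?_
        linear_combination hξ.2 - hξ'.2
    have hdiag : ∑ p ∈ Q, (if p.1.1 = p.1.2 ∧ p.2.1 = p.2.2 then #K else 0) ≤ #K * #A ^ 2 := by
      rw [← sum_filter, sum_const, smul_eq_mul, mul_comm]
      gcongr
      rw [sq, ← card_product]
      refine card_le_card_of_injOn (fun p ↦ (p.1.1, p.2.1)) ?_ ?_
      · rintro ⟨⟨x, x'⟩, y, y'⟩ hp
        simp only [Q, coe_filter, Set.mem_ofPred_eq, mem_product] at hp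
        simp [hp.1.1.1, hp.1.2.1]
      · rintro ⟨⟨x, x'⟩, y, y'⟩ hp ⟨⟨u, u'⟩, v, v'⟩ hq h
        simp only [coe_filter, Set.mem_ofPred_eq, Prod.mk.injEq] at hp hq h ⊢
        obtain ⟨-, rfl, rfl⟩ := hp
        obtain ⟨-, rfl, rfl⟩ := hq
        exact ⟨⟨h.1, h.1⟩, h.2, h.2⟩
    calc ∑ ξ ∈ K, E[A, ξ • A]
        ≤ ∑ p ∈ Q, #{ξ ∈ K | p.1.1 + ξ * p.2.1 = p.1.2 + ξ * p.2.2} :=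
          (sum_le_sum hE).trans_eq hswap
      _ ≤ ∑ p ∈ Q, (1 + if p.1.1 = p.1.2 ∧ p.2.1 = p.2.2 then #K else 0) := sum_le_sum hp
      _ = #A ^ 4 + ∑ p ∈ Q, (if p.1.1 = p.1.2 ∧ p.2.1 = p.2.2 then #K else 0) := by
          rw [sum_add_distrib, sum_const, smul_eq_mul, mul_one]
          simp only [Q, card_product]
          ring
      _ ≤ _ := by gcongr
  have hsum : (#K : ℝ) * ((#A : ℝ) ^ 3 / M) ≤ (#A : ℝ) ^ 4 + #K * (#A : ℝ) ^ 2 := by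
    calc (#K : ℝ) * ((#A : ℝ) ^ 3 / M) = ∑ _ξ ∈ K, (#A : ℝ) ^ 3 / M := by
          rw [sum_const, nsmul_eq_mul]
      _ ≤ ∑ ξ ∈ K, (E[A, ξ • A] : ℝ) := sum_le_sum lower
      _ ≤ _ := by exact_mod_cast upper
  rw [mul_div_assoc', div_le_iff₀ hM] at hsum
  -- The diagonal contribution is at most half of the left side of `hsum`, by 2M ≤ #A.
  have h2 : (#K : ℝ) * (#A : ℝ) ^ 2 * (2 * M) ≤ #K * (#A : ℝ) ^ 2 * #A := by gcongr
  refine le_of_mul_le_mul_right ?_ (pow_pos hApos 3)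
  nlinarith

/-- A subring of a finite field, as a subfield. -/
def Subring.toSubfieldOfFinite [Finite F] (S : Subring F) : Subfield F :=
  { S with
    inv_mem' := fun x hx ↦ by
      have := Fintype.ofFinite F
      obtain rfl | h := eq_or_ne x 0
      · simp
      · have hq : Fintype.card F - 1 ≠ 0 := by
          have := Fintype.one_lt_card (α := F); omega
        have e : x⁻¹ = x ^ (Fintype.card F - 1 - 1) := by
          rw [inv_eq_iff_eq_inv, ← one_mul (x ^ _)⁻¹, eq_mul_inv_iff_mul_eq₀ (pow_ne_zero _ h),
            ← pow_succ', Nat.sub_add_cancel (Nat.pos_of_ne_zero hq)]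
          exact FiniteField.pow_card_sub_one_eq_one x h
        rw [e]
        exact S.pow_mem hx _ }

/-- **Sum-product dichotomy in finite fields.** A set `A'` whose elements `y` all make `A - y A`
small is either small itself or a large part of a subfield. -/
theorem exists_subfield_of_card_sub_smul_le [Fintype F] (hA' : A' ⊆ A) (h1 : 1 ∈ A')
    (h0 : 0 ∉ A') (hcard : (#A : ℝ) ≤ 2 * #A')
    (hT : ∀ y ∈ A', (#(A - y • A) : ℝ) ≤ T * #A) (hlarge : 4096 * T ^ 5 < #A') :
    ∃ K : Subfield F, (A' : Set F) ⊆ K ∧ (Nat.card K : ℝ) ≤ 2048 * T ^ 4 * #A' := by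
  have hne' : A'.Nonempty := ⟨1, h1⟩
  have hne : A.Nonempty := hne'.mono hA'
  have hT1 := one_le_of_card_sub_smul_le hne h1 hT
  have hT5 : T ^ 4 ≤ T ^ 5 := pow_le_pow_right₀ hT1 (by norm_num)
  have hT4 : 1 ≤ T ^ 4 := one_le_pow₀ hT1
  have h1lt : 1 < #A' := by
    have : (1 : ℝ) < #A' := by linarith
    exact_mod_cast this
  obtain ⟨a, ha, b, hb, hab⟩ := one_lt_card.1 h1lt
  have hR := ringClosure_subset_diffQuotients h0 ha hb hab
    (fun r hr ↦ by
      by_contra h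
      exact hlarge.not_ge (card_le_of_sub_one_notMem_diffQuotients hA' h1 hcard hT hr h))
    (fun r hr y hy ↦ by
      by_contra h
      exact hlarge.not_ge (card_le_of_mul_notMem_diffQuotients hA' h1 h0 hcard hT hr hy h))
  refine ⟨(Subring.closure (A' : Set F)).toSubfieldOfFinite, Subring.subset_closure, ?_⟩
  obtain ⟨K, hK⟩ : ∃ K : Finset F, ∀ x, x ∈ K ↔ x ∈ Subring.closure (A' : Set F) :=
    ⟨(Set.toFinite (Subring.closure (A' : Set F) : Set F)).toFinset, fun x ↦ by simp⟩
  have hKcard : Nat.card (Subring.closure (A' : Set F)).toSubfieldOfFinite = #K := by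
    exact Nat.subtype_card K hK
  rw [hKcard]
  -- Here 512 is 256 times the loss in #A ≤ 2 #A'. The final constant 2048 leaves room for the
  -- element 0.
  have hK0 : (#(K.erase 0) : ℝ) ≤ 2 * (512 * T ^ 4) * #A' := by
    refine card_le_of_forall_card_add_smul_le (M := 512 * T ^ 4) (K := K.erase 0) hne'
      (by positivity) (by linarith) ?_ (notMem_erase 0 K)
    intro ξ hξ
    have hξR : ξ ∈ diffQuotients A' := hR ((hK ξ).1 (mem_of_mem_erase hξ))
    have hmono : #(A' + ξ • A') ≤ #(A + ξ • A) :=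
      card_le_card (add_subset_add hA' (smul_finset_subset_smul_finset hA'))
    have hmono' : (#(A' + ξ • A') : ℝ) ≤ #(A + ξ • A) := by exact_mod_cast hmono
    have hbound := card_add_smul_le_of_mem_diffQuotients hne hT hξR
    have hscale : 256 * T ^ 4 * (#A : ℝ) ≤ 256 * T ^ 4 * (2 * #A') := by gcongr
    linarith
  have hle : (#K : ℝ) ≤ #(K.erase 0) + 1 := by
    exact_mod_cast Nat.sub_le_iff_le_add.1 pred_card_le_card_erase
  have h1A : (1 : ℝ) ≤ #A' := by exact_mod_cast hne'.card_pos
  nlinarith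

end SumProduct

/-! ### Balog–Szemerédi–Gowers for Cayley graphs on a multiplicative group -/

section Energy

open Finset
open scoped Pointwise

variable {F : Type*} [Field F] [DecidableEq F]

/-- A finite set that is a subgroup of the unit group of a field. -/
structure IsUnitSubgroup (G : Finset F) : Prop where
  one_mem : 1 ∈ G
  zero_notMem : 0 ∉ G
  mul_mem : ∀ a ∈ G, ∀ b ∈ G, a * b ∈ G
  inv_mem : ∀ a ∈ G, a⁻¹ ∈ G

variable {G N P : Finset F}

omit [DecidableEq F] in
theorem IsUnitSubgroup.ne_zero (hG : IsUnitSubgroup G) {a : F} (ha : a ∈ G) : a ≠ 0 :=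
  fun h ↦ hG.zero_notMem (h ▸ ha)

theorem card_smul_inter_smul {a : F} (ha : a ≠ 0) (b : F) (N : Finset F) :
    #(a • N ∩ b • N) = #(N ∩ (b / a) • N) := by
  have h : a • N ∩ b • N = a • (N ∩ (b / a) • N) := by
    rw [smul_finset_inter₀ ha, smul_smul, mul_div_cancel₀ _ ha]
  rw [h, card_smul_finset_of_ne_zero ha]

/-- In a Cayley graph, few pairs of neighbours of `1` have few common neighbours. -/
theorem card_pairs_few_common_le (hG : IsUnitSubgroup G) (hN : N ⊆ G) {θ : ℝ} (hθ : 0 ≤ θ) :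
    (#{p ∈ N ×ˢ N | (#(p.1 • N ∩ p.2 • N) : ℝ) < θ} : ℝ) ≤ θ * #G := by
  set B := {p ∈ N ×ˢ N | (#(p.1 • N ∩ p.2 • N) : ℝ) < θ} with hB
  have hmaps : ∀ p ∈ B, p.2 / p.1 ∈ G := by
    intro p hp
    have hp := mem_product.1 (mem_filter.1 hp).1
    rw [div_eq_mul_inv]
    exact hG.mul_mem _ (hN hp.2) _ (hG.inv_mem _ (hN hp.1))
  rw [card_eq_sum_card_fiberwise hmaps]
  push_cast
  -- A pair (u, v) of ratio y is determined by v ∈ N ∩ yN, and this intersection has the same size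
  -- as uN ∩ vN, which is below θ.
  have hfib : ∀ y ∈ G, (#{p ∈ B | p.2 / p.1 = y} : ℝ) ≤ θ := by
    intro y hy
    obtain h | ⟨p, hp⟩ := Finset.eq_empty_or_nonempty {p ∈ B | p.2 / p.1 = y}
    · rw [h]; simpa using hθ
    have hle : #{p ∈ B | p.2 / p.1 = y} ≤ #(N ∩ y • N) := by
      refine card_le_card_of_injOn (fun p ↦ p.2) ?_ ?_
      · rintro ⟨u, v⟩ hp
        simp only [hB, coe_filter, mem_filter, mem_product, Set.mem_ofPred_eq] at hp
        obtain ⟨⟨⟨hu, hv⟩, -⟩, rfl⟩ := hp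
        refine mem_coe.2 (mem_inter.2 ⟨hv, mem_smul_finset.2 ⟨u, hu, ?_⟩⟩)
        exact div_mul_cancel₀ _ (hG.ne_zero (hN hu))
      · rintro ⟨u, v⟩ hp ⟨u', v'⟩ hp' h
        simp only [hB, coe_filter, mem_filter, mem_product, Set.mem_ofPred_eq] at hp hp' h
        subst h
        have h0 := hG.ne_zero (hN hp.1.1.1)
        have h0' := hG.ne_zero (hN hp'.1.1.1)
        have hv := hG.ne_zero (hN hp.1.1.2)
        have e := hp.2.trans hp'.2.symm
        rw [div_eq_div_iff h0 h0'] at e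
        simp [mul_left_cancel₀ hv e]
    obtain ⟨hpB, rfl⟩ := mem_filter.1 hp
    obtain ⟨hpN, hlt⟩ := mem_filter.1 hpB
    rw [card_smul_inter_smul (hG.ne_zero (hN (mem_product.1 hpN).1))] at hlt
    exact (Nat.cast_le.2 hle).trans hlt.le
  calc ∑ y ∈ G, (#{p ∈ B | p.2 / p.1 = y} : ℝ) ≤ ∑ _y ∈ G, θ := sum_le_sum hfib
    _ = θ * #G := by rw [sum_const, nsmul_eq_mul, mul_comm]

/-- Counting walks of length four between `A` and `y A`. -/
theorem card_sub_smul_mul_le (hG : IsUnitSubgroup G) (hN : N ⊆ G)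
    (hneg : ∀ z ∈ P, -z ∈ P) (hPG : ∀ g ∈ G, ∀ z ∈ P, g * z ∈ P) (hNP : ∀ y ∈ N, 1 - y ∈ P)
    {θ₁ θ₂ : ℝ} (hθ₁ : 0 ≤ θ₁) {A : Finset F} (hA : A ⊆ N)
    (hgood : ∀ a ∈ A, (#{c ∈ N | (#(a • N ∩ c • N) : ℝ) < θ₁} : ℝ) ≤ θ₂ / 4)
    {y : F} (hy : y ∈ G) (hyN : θ₂ ≤ #(N ∩ y • N)) :
    (#(A - y • A) : ℝ) * (θ₂ / 2 * θ₁ ^ 2) ≤ (#P : ℝ) ^ 4 := by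
  let Q := (P ×ˢ P) ×ˢ (P ×ˢ P)
  let f : (F × F) × (F × F) → F := fun q ↦ q.1.1 + q.1.2 + q.2.1 + q.2.2
  have hadj : ∀ a ∈ G, ∀ z ∈ a • N, a - z ∈ P := by
    intro a ha z hz
    obtain ⟨n, hn, rfl⟩ := mem_smul_finset.1 hz
    have := hPG a ha _ (hNP n hn)
    rwa [mul_sub, mul_one] at this
  have hadj' : ∀ a ∈ G, ∀ z ∈ a • N, z - a ∈ P := by
    intro a ha z hz
    rw [← neg_sub]
    exact hneg _ (hadj a ha z hz)
  have hy0 := hG.ne_zero hy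
  -- Each walk a, z, c, w, b with b = ya' writes a - b as a sum of four elements of P. The midpoint
  -- c runs over D, and z and w over common neighbours.
  have hfib : ∀ s ∈ A - y • A, θ₂ / 2 * θ₁ ^ 2 ≤ #{q ∈ Q | f q = s} := by
    intro s hs
    obtain ⟨a, ha, b, hb, rfl⟩ := mem_sub.1 hs
    obtain ⟨a', ha', rfl⟩ := mem_smul_finset.1 hb
    have haG := hN (hA ha)
    have ha'G := hN (hA ha')
    have hbG : y • a' ∈ G := hG.mul_mem _ hy _ ha'G
    set b := y • a' with hbdef
    let bad₁ : Finset F := {c ∈ N | (#(a • N ∩ c • N) : ℝ) < θ₁}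
    let bad₂ : Finset F := y • ({c ∈ N | (#(a' • N ∩ c • N) : ℝ) < θ₁} : Finset F)
    -- Elements of N serve as midpoints for a, elements of yN for ya' after dilation by y. Each
    -- endpoint excludes at most θ₂/4 of the at least θ₂ candidates.
    let D : Finset F := (N ∩ y • N) \ (bad₁ ∪ bad₂)
    have hDcard : θ₂ / 2 ≤ #D := by
      have h1 : #(N ∩ y • N) ≤ #D + (#bad₁ + #bad₂) :=
        (card_le_card (fun x hx ↦ by
          by_cases h : x ∈ bad₁ ∪ bad₂
          · exact mem_union_right _ h
          · exact mem_union_left _ (mem_sdiff.2 ⟨hx, h⟩))).trans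
          ((card_union_le D (bad₁ ∪ bad₂)).trans (Nat.add_le_add_left (card_union_le _ _) _))
      have h2 : (#(N ∩ y • N) : ℝ) ≤ #D + (#bad₁ + #bad₂) := by exact_mod_cast h1
      have h3 : (#bad₁ : ℝ) ≤ θ₂ / 4 := hgood a ha
      have h4 : (#bad₂ : ℝ) ≤ θ₂ / 4 := by
        simp only [bad₂]
        rw [card_smul_finset_of_ne_zero hy0]
        exact hgood a' ha'
      linarith
    have hD₁ : ∀ c ∈ D, θ₁ ≤ #(a • N ∩ c • N) := by
      intro c hc
      obtain ⟨hcN, hcb⟩ := mem_sdiff.1 hc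
      by_contra! h
      exact hcb (mem_union_left _ (mem_filter.2 ⟨(mem_inter.1 hcN).1, h⟩))
    have hD₂ : ∀ c ∈ D, θ₁ ≤ #(b • N ∩ c • N) := by
      intro c hc
      obtain ⟨hcN, hcb⟩ := mem_sdiff.1 hc
      obtain ⟨c', hc', rfl⟩ := mem_smul_finset.1 (mem_inter.1 hcN).2
      by_contra! h
      refine hcb (mem_union_right _ (smul_mem_smul_finset (mem_filter.2 ⟨hc', ?_⟩)))
      rw [card_smul_inter_smul (hG.ne_zero ha'G)]
      rw [card_smul_inter_smul (hG.ne_zero hbG), hbdef, smul_eq_mul, smul_eq_mul,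
        mul_div_mul_left _ _ hy0] at h
      exact h
    have hDG : ∀ c ∈ D, c ∈ G := fun c hc ↦ hN (mem_inter.1 (mem_sdiff.1 hc).1).1
    let S : Finset (Σ _ : F, F × F) := D.sigma fun c ↦ (a • N ∩ c • N) ×ˢ (b • N ∩ c • N)
    have hS : θ₂ / 2 * θ₁ ^ 2 ≤ #S := by
      have hSc : (#S : ℝ) = ∑ c ∈ D, (#(a • N ∩ c • N) : ℝ) * #(b • N ∩ c • N) := by
        simp [S, card_sigma, card_product]
      rw [hSc]
      calc θ₂ / 2 * θ₁ ^ 2 ≤ #D * θ₁ ^ 2 := by gcongr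
        _ = ∑ _c ∈ D, θ₁ * θ₁ := by rw [sum_const, nsmul_eq_mul, sq]
        _ ≤ _ := sum_le_sum fun c hc ↦
          mul_le_mul (hD₁ c hc) (hD₂ c hc) hθ₁ (Nat.cast_nonneg _)
    refine hS.trans (Nat.cast_le.2 ?_)
    refine card_le_card_of_injOn
      (fun x ↦ ((a - x.2.1, x.2.1 - x.1), (x.1 - x.2.2, x.2.2 - b))) ?_ ?_
    · rintro ⟨c, z, w⟩ hx
      obtain ⟨hc, hzw⟩ := mem_sigma.1 hx
      obtain ⟨hz, hw⟩ := mem_product.1 hzw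
      obtain ⟨hz1, hz2⟩ := mem_inter.1 hz
      obtain ⟨hw1, hw2⟩ := mem_inter.1 hw
      refine mem_coe.2 (mem_filter.2 ⟨mem_product.2 ⟨mem_product.2 ⟨?_, ?_⟩,
        mem_product.2 ⟨?_, ?_⟩⟩, ?_⟩)
      · exact hadj a haG z hz1
      · exact hadj' c (hDG c hc) z hz2
      · exact hadj c (hDG c hc) w hw2
      · exact hadj' b hbG w hw1
      · simp only [f]; ring
    · rintro ⟨c, z, w⟩ _ ⟨c', z', w'⟩ _ h
      simp only [Prod.mk.injEq, sub_right_inj, sub_left_inj] at h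
      obtain ⟨⟨rfl, h2⟩, h3, rfl⟩ := h
      rw [sub_right_inj] at h2
      subst h2
      rfl
  have hsum : ∑ s ∈ A - y • A, #{q ∈ Q | f q = s} ≤ #P ^ 4 := by
    rw [sum_card_fiberwise_eq_card_filter]
    refine (card_filter_le _ _).trans_eq ?_
    simp only [Q, card_product]
    ring
  calc (#(A - y • A) : ℝ) * (θ₂ / 2 * θ₁ ^ 2) = ∑ _s ∈ A - y • A, θ₂ / 2 * θ₁ ^ 2 := by
        rw [sum_const, nsmul_eq_mul]
    _ ≤ ∑ s ∈ A - y • A, (#{q ∈ Q | f q = s} : ℝ) := sum_le_sum hfib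
    _ ≤ (#P : ℝ) ^ 4 := by exact_mod_cast hsum

/-- With the thresholds θ₂ = d²/(16τ) and θ₁ = d³/(256τ²), the walk count θ₂θ₁²/2 equals d^8/(2^21
τ^5). The hypothesis d ≤ 2a converts the bound into a multiple of a. -/
theorem card_bound_of_walk_bound {d τ a P x : ℝ} (hd : 0 < d) (hτ : 0 < τ) (ha : d ≤ 2 * a)
    (h : x * (d ^ 2 / (16 * τ) / 2 * (d ^ 3 / (256 * τ ^ 2)) ^ 2) ≤ P ^ 4) :
    x ≤ 2 ^ 22 * P ^ 4 * τ ^ 5 / d ^ 9 * a := by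
  have h6 : d ^ 2 / (16 * τ) / 2 * (d ^ 3 / (256 * τ ^ 2)) ^ 2 = d ^ 8 / (2 ^ 21 * τ ^ 5) := by
    field_simp; norm_num
  rw [h6, mul_div_assoc', div_le_iff₀ (by positivity)] at h
  rw [div_mul_eq_mul_div, le_div_iff₀ (by positivity)]
  calc x * d ^ 9 = x * d ^ 8 * d := by ring
    _ ≤ (P ^ 4 * (2 ^ 21 * τ ^ 5)) * d := by gcongr
    _ ≤ (P ^ 4 * (2 ^ 21 * τ ^ 5)) * (2 * a) := by gcongr
    _ = _ := by ring

/-- **Balog–Szemerédi–Gowers for Cayley graphs.** -/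
theorem exists_subsets_card_sub_smul_le (hG : IsUnitSubgroup G) (hN : N ⊆ G) (hne : N.Nonempty)
    (hneg : ∀ z ∈ P, -z ∈ P) (hPG : ∀ g ∈ G, ∀ z ∈ P, g * z ∈ P) (hNP : ∀ y ∈ N, 1 - y ∈ P) :
    ∃ A A' : Finset F, A' ⊆ A ∧ A' ⊆ G ∧ 1 ∈ A' ∧ (#N : ℝ) ≤ 2 * #A' ∧ (#A : ℝ) ≤ 2 * #A' ∧
      ∀ y ∈ A', (#(A - y • A) : ℝ) ≤ 2 ^ 22 * (#P : ℝ) ^ 4 * (#G : ℝ) ^ 5 / (#N : ℝ) ^ 9 * #A := by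
  set d : ℝ := ((#N : ℕ) : ℝ) with hd
  set τ : ℝ := ((#G : ℕ) : ℝ) with hτ
  have hdpos : 0 < d := Nat.cast_pos.2 hne.card_pos
  have hdτ : d ≤ τ := Nat.cast_le.2 (card_le_card hN)
  have hτpos : 0 < τ := hdpos.trans_le hdτ
  -- θ₂τ = d²/16 makes unpopular pairs rare. θ₁τ = (d/4)(θ₂/4) leaves at most d/4 vertices of N
  -- outside A.
  set θ₂ : ℝ := d ^ 2 / (16 * τ) with hθ₂
  set θ₁ : ℝ := d ^ 3 / (256 * τ ^ 2) with hθ₁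
  have hθ₂pos : 0 < θ₂ := by positivity
  have hθ₁pos : 0 < θ₁ := by positivity
  set A : Finset F := {a ∈ N | (#{c ∈ N | (#(a • N ∩ c • N) : ℝ) < θ₁} : ℝ) ≤ θ₂ / 4} with hA
  have hAN : A ⊆ N := filter_subset _ _
  have hgood : ∀ a ∈ A, (#{c ∈ N | (#(a • N ∩ c • N) : ℝ) < θ₁} : ℝ) ≤ θ₂ / 4 :=
    fun a ha ↦ (mem_filter.1 ha).2
  have hpairs : ∀ (X : Finset F) (p : F × F → Prop) [DecidablePred p],
      #{x ∈ X ×ˢ X | p x} = ∑ a ∈ X, #{c ∈ X | p (a, c)} := by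
    intro X p _
    simp only [card_filter, sum_product]
  have hAcard : 3 / 4 * d ≤ #A := by
    have h1 : (#(N \ A) : ℝ) * (θ₂ / 4) ≤ θ₁ * τ := by
      refine le_trans ?_ (card_pairs_few_common_le hG hN hθ₁pos.le)
      rw [hpairs N fun x ↦ (#(x.1 • N ∩ x.2 • N) : ℝ) < θ₁]
      push_cast
      calc (#(N \ A) : ℝ) * (θ₂ / 4) = ∑ _a ∈ N \ A, θ₂ / 4 := by rw [sum_const, nsmul_eq_mul]
        _ ≤ ∑ a ∈ N \ A, (#{c ∈ N | (#(a • N ∩ c • N) : ℝ) < θ₁} : ℝ) := by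
          refine sum_le_sum fun a ha ↦ ?_
          obtain ⟨haN, haA⟩ := mem_sdiff.1 ha
          by_contra! h
          exact haA (mem_filter.2 ⟨haN, h.le⟩)
        _ ≤ _ := sum_le_sum_of_subset_of_nonneg sdiff_subset fun _ _ _ ↦ Nat.cast_nonneg _
    have h2 : (#(N \ A) : ℝ) + #A = d := by
      rw [hd]; exact_mod_cast card_sdiff_add_card_eq_card hAN
    have h3 : θ₁ * τ = d / 4 * (θ₂ / 4) := by
      rw [hθ₁, hθ₂]; field_simp; norm_num
    rw [h3] at h1
    have := le_of_mul_le_mul_right h1 (by positivity)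
    linarith
  have hApos : (0 : ℝ) < #A := by linarith
  have hAle : (#A : ℝ) ≤ d := Nat.cast_le.2 (card_le_card hAN)
  -- Averaging: otherwise the popular pairs number less than |A|d/2, against at least |A|² - d²/16
  -- with |A| ≥ 3d/4.
  obtain ⟨a₀, ha₀, ha₀card⟩ : ∃ a₀ ∈ A, d / 2 ≤ #{b ∈ A | θ₂ ≤ (#(a₀ • N ∩ b • N) : ℝ)} := by
    by_contra! h
    have h1 : (#{x ∈ A ×ˢ A | θ₂ ≤ (#(x.1 • N ∩ x.2 • N) : ℝ)} : ℝ) < #A * (d / 2) := by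
      rw [hpairs A fun x ↦ θ₂ ≤ (#(x.1 • N ∩ x.2 • N) : ℝ)]
      push_cast
      calc _ < ∑ _a ∈ A, d / 2 :=
            sum_lt_sum_of_nonempty (card_pos.1 (by exact_mod_cast hApos)) h
        _ = _ := by rw [sum_const, nsmul_eq_mul]
    have h2 : (#{x ∈ A ×ˢ A | (#(x.1 • N ∩ x.2 • N) : ℝ) < θ₂} : ℝ) ≤ θ₂ * τ :=
      (Nat.cast_le.2 (card_le_card (filter_subset_filter _ (product_subset_product hAN hAN)))).trans
        (card_pairs_few_common_le hG hN hθ₂pos.le)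
    have h3 : #{x ∈ A ×ˢ A | θ₂ ≤ (#(x.1 • N ∩ x.2 • N) : ℝ)} +
        #{x ∈ A ×ˢ A | (#(x.1 • N ∩ x.2 • N) : ℝ) < θ₂} = #A * #A := by
      have h := card_filter_add_card_filter_not (s := A ×ˢ A)
        (fun x : F × F ↦ θ₂ ≤ (#(x.1 • N ∩ x.2 • N) : ℝ))
      simpa only [not_le, card_product] using h
    have h4 : (#{x ∈ A ×ˢ A | θ₂ ≤ (#(x.1 • N ∩ x.2 • N) : ℝ)} : ℝ) +
        #{x ∈ A ×ˢ A | (#(x.1 • N ∩ x.2 • N) : ℝ) < θ₂} = #A * #A := by exact_mod_cast h3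
    have h5 : θ₂ * τ = d ^ 2 / 16 := by rw [hθ₂]; field_simp
    nlinarith
  have ha₀G := hN (hAN ha₀)
  have ha₀0 := hG.ne_zero ha₀G
  have hinv0 : a₀⁻¹ ≠ 0 := inv_ne_zero ha₀0
  set B : Finset F := {b ∈ A | θ₂ ≤ (#(a₀ • N ∩ b • N) : ℝ)} with hB
  have hBA : B ⊆ A := filter_subset _ _
  -- Dividing by a₀ places 1 in the smaller set and turns popularity with a₀ into popularity with 1.
  refine ⟨a₀⁻¹ • A, a₀⁻¹ • B, smul_finset_subset_smul_finset hBA, ?_, ?_, ?_, ?_, ?_⟩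
  · intro x hx
    obtain ⟨b, hb, rfl⟩ := mem_smul_finset.1 hx
    exact hG.mul_mem _ (hG.inv_mem _ ha₀G) _ (hN (hAN (hBA hb)))
  · refine mem_smul_finset.2 ⟨a₀, mem_filter.2 ⟨ha₀, ?_⟩, inv_mul_cancel₀ ha₀0⟩
    rw [inter_self, card_smul_finset_of_ne_zero ha₀0, hθ₂, div_le_iff₀ (by positivity)]
    nlinarith
  · rw [card_smul_finset_of_ne_zero hinv0]; linarith
  · rw [card_smul_finset_of_ne_zero hinv0, card_smul_finset_of_ne_zero hinv0]; linarith
  · intro y hy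
    obtain ⟨b, hb, rfl⟩ := mem_smul_finset.1 hy
    have hbA := hBA hb
    have hyG : a₀⁻¹ * b ∈ G := hG.mul_mem _ (hG.inv_mem _ ha₀G) _ (hN (hAN hbA))
    have hyN : θ₂ ≤ #(N ∩ (a₀⁻¹ * b) • N) := by
      have := (mem_filter.1 hb).2
      rwa [card_smul_inter_smul ha₀0, div_eq_inv_mul] at this
    have key := card_sub_smul_mul_le hG hN hneg hPG hNP hθ₁pos.le hAN hgood hyG hyN
    have e : a₀⁻¹ • A - (a₀⁻¹ • b) • a₀⁻¹ • A = a₀⁻¹ • (A - (a₀⁻¹ * b) • A) := by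
      rw [sub_eq_add_neg, sub_eq_add_neg, smul_add, smul_finset_neg, smul_eq_mul, smul_comm]
    rw [e, card_smul_finset_of_ne_zero hinv0, card_smul_finset_of_ne_zero hinv0]
    exact card_bound_of_walk_bound hdpos hτpos (by linarith) key

end Energy

/-! ### Additive energy of multiplicative subgroups -/

section EnergyBound

open Finset
open scoped Pointwise

variable {F : Type*} [Field F] [DecidableEq F] [Fintype F] {G P : Finset F}

/-- A set of differences popular in the subgroup `G` spans few elements. -/
theorem card_neighbours_pow_le (hG : IsUnitSubgroup G)
    (hneg : ∀ z ∈ P, -z ∈ P) (hPG : ∀ g ∈ G, ∀ z ∈ P, g * z ∈ P) {C : ℝ}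
    (hsub : ∀ K : Subfield F, K ≠ ⊤ → ∀ B ⊆ G, (B : Set F) ⊆ K → (#B : ℝ) ≤ C * √(Nat.card K))
    (hq : #G ^ 9 ≤ Fintype.card F ^ 5) (hne : {y ∈ G | 1 - y ∈ P}.Nonempty) :
    (#{y ∈ G | 1 - y ∈ P} : ℝ) ^ 46 ≤
      (2 ^ 15 + 2 ^ 12 * C ^ 2) * 2 ^ 110 * (#P : ℝ) ^ 20 * (#G : ℝ) ^ 25 := by
  set N : Finset F := {y ∈ G | 1 - y ∈ P} with hN
  obtain ⟨A, A', hA', hA'G, h1, hNA', hcard, hT⟩ := exists_subsets_card_sub_smul_le hG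
    (filter_subset _ _) hne hneg hPG (fun y hy ↦ (mem_filter.1 hy).2)
  set T : ℝ := 2 ^ 22 * (#P : ℝ) ^ 4 * (#G : ℝ) ^ 5 / (#N : ℝ) ^ 9 with hTdef
  have hA'ne : A'.Nonempty := ⟨1, h1⟩
  have hT1 : 1 ≤ T := one_le_of_card_sub_smul_le (hA'ne.mono hA') h1 hT
  have hA'pos : (0 : ℝ) < #A' := by exact_mod_cast hA'ne.card_pos
  have hT45 : T ^ 4 ≤ T ^ 5 := pow_le_pow_right₀ hT1 (by norm_num)
  have hT5 : 0 ≤ T ^ 5 := by positivity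
  have hA'leG : (#A' : ℝ) ≤ #G := by exact_mod_cast card_le_card hA'G
  have main : (#A' : ℝ) ≤ (2 ^ 14 + 2 ^ 11 * C ^ 2) * T ^ 5 := by
    by_cases hlarge : 4096 * T ^ 5 < #A'
    · obtain ⟨K, hK, hKcard⟩ := exists_subfield_of_card_sub_smul_le hA' h1
        (fun h ↦ hG.zero_notMem (hA'G h)) hcard hT hlarge
      by_cases htop : K = ⊤
      · have hKF : Nat.card K = Fintype.card F := by
          rw [htop, ← Nat.card_eq_fintype_card]
          exact Nat.card_congr Subfield.topEquiv.toEquiv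
        rw [hKF] at hKcard
        have hGpos : (0 : ℝ) < #G := hA'pos.trans_le hA'leG
        -- The full field has at most 2048 T^4 #G elements. Its fifth power against #G^9 leaves #G^4
        -- ≤ 2^55 T^20, and 2^55 is rounded up to the fourth power 2^56.
        have h3 : (#G : ℝ) ^ 4 * (#G : ℝ) ^ 5 ≤ (2 ^ 14 * T ^ 5) ^ 4 * (#G : ℝ) ^ 5 := by
          calc (#G : ℝ) ^ 4 * (#G : ℝ) ^ 5 = (#G : ℝ) ^ 9 := by ring
            _ ≤ (Fintype.card F : ℝ) ^ 5 := by exact_mod_cast hq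
            _ ≤ (2048 * T ^ 4 * #A') ^ 5 := by gcongr
            _ ≤ (2048 * T ^ 4 * #G) ^ 5 := by gcongr
            _ = 2 ^ 55 * (T ^ 20 * (#G : ℝ) ^ 5) := by ring
            _ ≤ 2 ^ 56 * (T ^ 20 * (#G : ℝ) ^ 5) := by gcongr <;> norm_num
            _ = _ := by ring
        have h4 := le_of_mul_le_mul_right h3 (by positivity)
        have h5 := le_of_pow_le_pow_left₀ (by norm_num) (by positivity) h4
        nlinarith [mul_nonneg (sq_nonneg C) hT5]
      · have h2 : (#A' : ℝ) ≤ C * √(Nat.card K) := hsub K htop A' hA'G hK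
        have h3 : (#A' : ℝ) ^ 2 ≤ C ^ 2 * (2048 * T ^ 4 * #A') := by
          calc (#A' : ℝ) ^ 2 ≤ (C * √(Nat.card K)) ^ 2 := by gcongr
            _ = C ^ 2 * Nat.card K := by rw [mul_pow, Real.sq_sqrt (Nat.cast_nonneg _)]
            _ ≤ _ := by gcongr
        have h4 : (#A' : ℝ) ≤ C ^ 2 * 2048 * T ^ 4 := by
          refine le_of_mul_le_mul_right ?_ hA'pos
          calc (#A' : ℝ) * #A' = (#A' : ℝ) ^ 2 := by ring
            _ ≤ _ := h3
            _ = _ := by ring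
        have h5 : C ^ 2 * 2048 * T ^ 4 ≤ C ^ 2 * 2048 * T ^ 5 := by gcongr
        nlinarith
    · nlinarith [mul_nonneg (sq_nonneg C) hT5]
  have hNpos : (0 : ℝ) < #N := by exact_mod_cast hne.card_pos
  have h6 : (#N : ℝ) ≤ (2 ^ 15 + 2 ^ 12 * C ^ 2) * T ^ 5 := by linarith
  have h7 : T ^ 5 = 2 ^ 110 * (#P : ℝ) ^ 20 * (#G : ℝ) ^ 25 / (#N : ℝ) ^ 45 := by
    rw [hTdef, div_pow]; ring
  rw [h7, mul_div_assoc', le_div_iff₀ (by positivity)] at h6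
  calc (#N : ℝ) ^ 46 = #N * (#N : ℝ) ^ 45 := by ring
    _ ≤ _ := h6
    _ = _ := by ring

omit [Fintype F] in
/-- The number of representations of `z` as a difference of elements of `G`. -/
def diffReps (G : Finset F) (z : F) : ℕ := #{p ∈ G ×ˢ G | p.1 - p.2 = z}

omit [Fintype F] in
theorem diffReps_neg (G : Finset F) (z : F) : diffReps G (-z) = diffReps G z := by
  have key : ∀ z, diffReps G z ≤ diffReps G (-z) := by
    intro z
    refine card_le_card_of_injOn Prod.swap ?_ Prod.swap_injective.injOn
    rintro ⟨a, b⟩ hp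
    simp only [coe_filter, mem_product, Set.mem_ofPred_eq, Prod.swap_prod_mk] at hp ⊢
    exact ⟨⟨hp.1.2, hp.1.1⟩, by rw [← hp.2, neg_sub]⟩
  exact le_antisymm (by simpa using key (-z)) (key z)

omit [Fintype F] in
theorem diffReps_mul (hG : IsUnitSubgroup G) {g : F} (hg : g ∈ G) (z : F) :
    diffReps G (g * z) = diffReps G z := by
  have key : ∀ g ∈ G, ∀ z, diffReps G z ≤ diffReps G (g * z) := by
    intro g hg z
    refine card_le_card_of_injOn (fun p ↦ (g * p.1, g * p.2)) ?_ ?_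
    · rintro ⟨a, b⟩ hp
      simp only [coe_filter, mem_product, Set.mem_ofPred_eq] at hp ⊢
      exact ⟨⟨hG.mul_mem _ hg _ hp.1.1, hG.mul_mem _ hg _ hp.1.2⟩, by rw [← hp.2]; ring⟩
    · rintro ⟨a, b⟩ _ ⟨a', b'⟩ _ h
      simpa [hG.ne_zero hg] using h
  refine le_antisymm ?_ (key g hg z)
  have := key _ (hG.inv_mem g hg) (g * z)
  rwa [inv_mul_cancel_left₀ (hG.ne_zero hg)] at this

omit [Fintype F] in
theorem diffReps_le (G : Finset F) (z : F) : diffReps G z ≤ #G := by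
  refine card_le_card_of_injOn Prod.fst ?_ ?_
  · rintro ⟨a, b⟩ hp
    exact (mem_product.1 (mem_filter.1 hp).1).1
  · rintro ⟨a, b⟩ hp ⟨a', b'⟩ hp' h
    simp only [coe_filter, mem_product, Set.mem_ofPred_eq] at hp hp' h
    subst h
    have := hp.2.trans hp'.2.symm
    rw [sub_right_inj] at this
    rw [this]

omit [Fintype F] in
-- Since a - b = a(1 - b/a) and P is G-invariant, the pair (a, b) may be replaced by (a, b/a).
theorem sum_diffReps (hG : IsUnitSubgroup G) (P : Finset F)
    (hPG : ∀ g ∈ G, ∀ z ∈ P, g * z ∈ P) :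
    ∑ z ∈ P, diffReps G z = #G * #{y ∈ G | 1 - y ∈ P} := by
  unfold diffReps
  rw [sum_card_fiberwise_eq_card_filter, ← card_product]
  refine card_nbij' (fun p ↦ (p.1, p.1⁻¹ * p.2)) (fun p ↦ (p.1, p.1 * p.2)) ?_ ?_ ?_ ?_
  · rintro ⟨a, b⟩ hp
    simp only [coe_filter, mem_product, Set.mem_ofPred_eq, coe_product, Set.mem_prod, mem_coe]
      at hp ⊢
    have hi := hG.inv_mem _ hp.1.1
    refine ⟨hp.1.1, hG.mul_mem _ hi _ hp.1.2, ?_⟩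
    have := hPG _ hi _ hp.2
    rwa [mul_sub, inv_mul_cancel₀ (hG.ne_zero hp.1.1)] at this
  · rintro ⟨a, b⟩ hp
    simp only [coe_filter, mem_product, Set.mem_ofPred_eq, coe_product, Set.mem_prod, mem_coe]
      at hp ⊢
    refine ⟨⟨hp.1, hG.mul_mem _ hp.1 _ hp.2.1⟩, ?_⟩
    have := hPG _ hp.1 _ hp.2.2
    rwa [mul_sub, mul_one] at this
  · rintro ⟨a, b⟩ hp
    have h0 := hG.ne_zero (mem_product.1 (mem_filter.1 hp).1).1
    simp [mul_inv_cancel_left₀ h0]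
  · rintro ⟨a, b⟩ hp
    have h0 := hG.ne_zero (mem_product.1 hp).1
    simp [inv_mul_cancel_left₀ h0]

/-- Eliminating P through tP ≤ τd turns the neighbour bound into t^20 d^26 ≪ τ^45. In (tτd)^26 the
remaining t^6 is at most τ^6, whence the exponent 77 = 26 + 6 + 45. -/
theorem energy_pow_le_of_level {C τ d t P L E : ℝ} (hτ : 0 < τ) (hd : 0 < d)
    (ht : 0 < t) (htτ : t ≤ τ) (hP : t * P ≤ τ * d) (hP0 : 0 ≤ P) (hE0 : 0 ≤ E)
    (hE : E ≤ L * (2 * t * (τ * d)))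
    (h : d ^ 46 ≤ (2 ^ 15 + 2 ^ 12 * C ^ 2) * 2 ^ 110 * P ^ 20 * τ ^ 25) :
    E ^ 26 ≤ (2 ^ 15 + 2 ^ 12 * C ^ 2) * 2 ^ 136 * L ^ 26 * τ ^ 77 := by
  set c := 2 ^ 15 + 2 ^ 12 * C ^ 2 with hc
  have hc0 : 0 < c := by positivity
  have h1 : t ^ 20 * d ^ 26 ≤ c * 2 ^ 110 * τ ^ 45 := by
    refine le_of_mul_le_mul_right ?_ (pow_pos hd 20)
    calc t ^ 20 * d ^ 26 * d ^ 20 = t ^ 20 * d ^ 46 := by ring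
      _ ≤ t ^ 20 * (c * 2 ^ 110 * P ^ 20 * τ ^ 25) := by gcongr
      _ = c * 2 ^ 110 * τ ^ 25 * (t * P) ^ 20 := by ring
      _ ≤ c * 2 ^ 110 * τ ^ 25 * (τ * d) ^ 20 := by gcongr
      _ = _ := by ring
  calc E ^ 26 ≤ (L * (2 * t * (τ * d))) ^ 26 := by gcongr
    _ = L ^ 26 * 2 ^ 26 * τ ^ 26 * t ^ 6 * (t ^ 20 * d ^ 26) := by ring
    _ ≤ L ^ 26 * 2 ^ 26 * τ ^ 26 * τ ^ 6 * (c * 2 ^ 110 * τ ^ 45) := by gcongr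
    _ = _ := by ring

/-- **Additive energy of multiplicative subgroups.** A subgroup of the unit group of a finite
field that has small intersections with all proper subfields has small additive energy. -/
theorem energy_pow_le (hG : IsUnitSubgroup G) {C : ℝ}
    (hsub : ∀ K : Subfield F, K ≠ ⊤ → ∀ B ⊆ G, (B : Set F) ⊆ K → (#B : ℝ) ≤ C * √(Nat.card K))
    (hq : #G ^ 9 ≤ Fintype.card F ^ 5) :
    ((∑ z, diffReps G z ^ 2 : ℕ) : ℝ) ^ 26 ≤
      (2 ^ 15 + 2 ^ 12 * C ^ 2) * 2 ^ 136 * (Nat.log 2 #G + 1 : ℕ) ^ 26 * (#G : ℝ) ^ 77 := by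
  set τ := #G with hτ
  have hτpos : 0 < τ := card_pos.2 ⟨1, hG.one_mem⟩
  set L := Nat.log 2 τ + 1 with hL
  -- Non-differences are excluded explicitly, because `Nat.log 2 0 = 0` would put them in level 0.
  let lev : ℕ → Finset F := fun j ↦ {z | diffReps G z ≠ 0 ∧ Nat.log 2 (diffReps G z) = j}
  set E := ∑ z, diffReps G z ^ 2 with hE
  have hEsum : E = ∑ j ∈ range L, ∑ z ∈ lev j, diffReps G z ^ 2 := by
    have h1 : E = ∑ z ∈ {z | diffReps G z ≠ 0}, diffReps G z ^ 2 := by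
      rw [sum_filter, hE]
      refine sum_congr rfl fun z _ ↦ ?_
      split_ifs with h
      · rfl
      · rw [not_not.1 h]; rfl
    rw [h1, ← sum_fiberwise_of_maps_to (t := range L) (g := fun z ↦ Nat.log 2 (diffReps G z))]
    · refine sum_congr rfl fun j _ ↦ sum_congr ?_ fun _ _ ↦ rfl
      simp only [lev, filter_filter]
    · intro z _
      exact mem_range.2 (Nat.lt_succ_of_le (Nat.log_mono_right (diffReps_le G z)))
  obtain ⟨j, hj, hEj⟩ : ∃ j ∈ range L, E ≤ L * ∑ z ∈ lev j, diffReps G z ^ 2 := by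
    by_contra! h
    have h1 : ∑ j ∈ range L, L * ∑ z ∈ lev j, diffReps G z ^ 2 < ∑ j ∈ range L, E :=
      sum_lt_sum_of_nonempty ⟨0, mem_range.2 (Nat.succ_pos _)⟩ h
    rw [← mul_sum, ← hEsum, sum_const, card_range, smul_eq_mul] at h1
    exact lt_irrefl _ h1
  set P := lev j with hP
  have hmemP : ∀ z, z ∈ P ↔ diffReps G z ≠ 0 ∧ Nat.log 2 (diffReps G z) = j := by
    intro z; simp [hP, lev]
  have hneg : ∀ z ∈ P, -z ∈ P := by
    intro z hz
    rw [hmemP, diffReps_neg]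
    exact (hmemP z).1 hz
  have hPG : ∀ g ∈ G, ∀ z ∈ P, g * z ∈ P := by
    intro g hg z hz
    rw [hmemP, diffReps_mul hG hg]
    exact (hmemP z).1 hz
  have hsumP := sum_diffReps hG P hPG
  set d := #{y ∈ G | 1 - y ∈ P} with hd
  have hlow : ∀ z ∈ P, 2 ^ j ≤ diffReps G z := by
    intro z hz
    obtain ⟨h0, h1⟩ := (hmemP z).1 hz
    rw [← h1]
    exact Nat.pow_log_le_self 2 h0
  have hupp : ∀ z ∈ P, diffReps G z ≤ 2 * 2 ^ j := by
    intro z hz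
    obtain ⟨h0, h1⟩ := (hmemP z).1 hz
    rw [← h1, mul_comm, ← pow_succ]
    exact (Nat.lt_pow_succ_log_self one_lt_two _).le
  have hEle : E ≤ L * (2 * 2 ^ j * (τ * d)) := by
    refine hEj.trans (Nat.mul_le_mul_left _ ?_)
    rw [← hsumP, mul_sum]
    refine sum_le_sum fun z hz ↦ ?_
    rw [sq]
    exact Nat.mul_le_mul_right _ (hupp z hz)
  have hPle : 2 ^ j * #P ≤ τ * d := by
    rw [← hsumP, mul_comm, ← smul_eq_mul, ← sum_const]
    exact sum_le_sum hlow
  have hE0 : 0 < E := by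
    refine sum_pos' (fun _ _ ↦ Nat.zero_le _) ⟨0, mem_univ _, ?_⟩
    refine pow_pos (card_pos.2 ⟨(1, 1), mem_filter.2 ⟨mem_product.2 ⟨hG.one_mem, hG.one_mem⟩, ?_⟩⟩) 2
    exact sub_self _
  have hd0 : 0 < d := by
    rcases Nat.eq_zero_or_pos d with h | h
    · rw [h] at hEle; simp at hEle; omega
    · exact h
  have htle : 2 ^ j ≤ τ := by
    have hPne : P.Nonempty := by
      rw [nonempty_iff_ne_empty]
      intro h
      rw [h, sum_empty] at hsumP
      exact (Nat.mul_pos hτpos hd0).ne hsumP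
    obtain ⟨z, hz⟩ := hPne
    exact (hlow z hz).trans (diffReps_le G z)
  have key := card_neighbours_pow_le hG hneg hPG hsub hq (card_pos.1 hd0)
  exact energy_pow_le_of_level (by exact_mod_cast hτpos) (by exact_mod_cast hd0)
    (t := (2 : ℝ) ^ j) (by positivity) (by exact_mod_cast htle) (by exact_mod_cast hPle)
    (Nat.cast_nonneg _) (Nat.cast_nonneg _) (by exact_mod_cast hEle) key

end EnergyBound

/-! ### Moments of character sums over a subgroup -/

section CharacterSums

open Finset
open scoped Pointwise ComplexConjugate

variable {F : Type*} [Field F] [Fintype F] [DecidableEq F]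

theorem conj_addChar_apply {G : Type*} [AddCommGroup G] [Finite G] (ψ : AddChar G ℂ) (x : G) :
    conj (ψ x) = ψ (-x) := by
  rw [AddChar.map_neg_eq_inv, Complex.inv_eq_conj (AddChar.norm_apply ψ x)]

/-- **Parseval's identity.** -/
theorem sum_norm_sq_fourier {ψ : AddChar F ℂ} (hψ : ψ.IsPrimitive) (f : F → ℂ) :
    ∑ ξ, ‖∑ z, f z * ψ (ξ * z)‖ ^ 2 = Fintype.card F * ∑ z, ‖f z‖ ^ 2 := by
  have key : ∑ ξ, (∑ z, f z * ψ (ξ * z)) * conj (∑ z, f z * ψ (ξ * z)) =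
      Fintype.card F * ∑ z, f z * conj (f z) := by
    calc ∑ ξ, (∑ z, f z * ψ (ξ * z)) * conj (∑ z, f z * ψ (ξ * z))
        = ∑ ξ, ∑ z, ∑ w, f z * conj (f w) * ψ (ξ * (z - w)) := by
          refine sum_congr rfl fun ξ _ ↦ ?_
          rw [map_sum, sum_mul_sum]
          refine sum_congr rfl fun z _ ↦ sum_congr rfl fun w _ ↦ ?_
          rw [map_mul (starRingEnd ℂ), conj_addChar_apply, mul_sub, sub_eq_add_neg,
            AddChar.map_add_eq_mul]
          ring
      _ = ∑ z, ∑ w, f z * conj (f w) * ∑ ξ, ψ (ξ * (z - w)) := by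
          rw [sum_comm]
          refine sum_congr rfl fun z _ ↦ ?_
          rw [sum_comm]
          exact sum_congr rfl fun w _ ↦ (mul_sum _ _ _).symm
      _ = ∑ z, f z * conj (f z) * Fintype.card F := by
          refine sum_congr rfl fun z _ ↦ ?_
          rw [sum_eq_single z]
          · rw [AddChar.sum_mulShift _ hψ, sub_self, if_pos rfl]
          · intro w _ hw
            rw [AddChar.sum_mulShift _ hψ, if_neg (sub_ne_zero.2 hw.symm), Nat.cast_zero, mul_zero]
          · simp
      _ = _ := by rw [← sum_mul, mul_comm]
  simp only [Complex.mul_conj, Complex.normSq_eq_norm_sq] at key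
  exact_mod_cast key

variable {G : Finset F}

/-- A quantity constant on the coset `a G` and summed over the field. -/
theorem card_mul_le_sum_of_invariant {h : F → ℝ} (h0 : ∀ ξ, 0 ≤ h ξ)
    (hinv : ∀ g ∈ G, ∀ ξ, h (g * ξ) = h ξ) {a : F} (ha : a ≠ 0) : #G * h a ≤ ∑ ξ, h ξ := by
  calc #G * h a = ∑ g ∈ G, h (g * a) := by
        rw [sum_congr rfl fun g hg ↦ hinv g hg a, sum_const, nsmul_eq_mul]
    _ = ∑ ξ ∈ G.image (· * a), h ξ := by
        rw [sum_image fun x _ y _ hxy ↦ mul_right_cancel₀ ha hxy]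
    _ ≤ _ := sum_le_sum_of_subset_of_nonneg (subset_univ _) fun _ _ _ ↦ h0 _

omit [Fintype F] [DecidableEq F] in
theorem sum_addChar_mul_invariant (hG : IsUnitSubgroup G) (ψ : AddChar F ℂ) {g : F} (hg : g ∈ G)
    (ξ : F) : ∑ x ∈ G, ψ (g * ξ * x) = ∑ x ∈ G, ψ (ξ * x) := by
  refine sum_nbij' (g * ·) (g⁻¹ * ·) (fun x hx ↦ hG.mul_mem _ hg _ hx)
    (fun x hx ↦ hG.mul_mem _ (hG.inv_mem _ hg) _ hx)
    (fun x _ ↦ inv_mul_cancel_left₀ (hG.ne_zero hg) x)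
    (fun x _ ↦ mul_inv_cancel_left₀ (hG.ne_zero hg) x) fun x _ ↦ ?_
  rw [mul_right_comm, mul_assoc, mul_comm]
  ring_nf

/-- Parseval for the indicator of G gives second moment q #G, and the coset aG contributes #G equal
terms. -/
theorem norm_sum_addChar_sq_le (hG : IsUnitSubgroup G) {ψ : AddChar F ℂ} (hψ : ψ.IsPrimitive)
    {a : F} (ha : a ≠ 0) : ‖∑ x ∈ G, ψ (a * x)‖ ^ 2 ≤ Fintype.card F := by
  have h := card_mul_le_sum_of_invariant (G := G) (h := fun ξ ↦ ‖∑ x ∈ G, ψ (ξ * x)‖ ^ 2)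
    (fun _ ↦ by positivity) (fun g hg ξ ↦ by rw [sum_addChar_mul_invariant hG ψ hg]) ha
  have hP := sum_norm_sq_fourier hψ (fun z ↦ if z ∈ G then 1 else 0)
  have e : ∀ ξ, ∑ z, (if z ∈ G then (1 : ℂ) else 0) * ψ (ξ * z) = ∑ x ∈ G, ψ (ξ * x) := by
    intro ξ
    simp [ite_mul, sum_ite_mem]
  have e2 : ∑ z, ‖if z ∈ G then (1 : ℂ) else 0‖ ^ 2 = #G := by
    simp [apply_ite, sum_ite_mem]
  simp only [e, e2] at hP
  rw [hP, mul_comm] at h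
  exact le_of_mul_le_mul_right h (by exact_mod_cast card_pos.2 ⟨1, hG.one_mem⟩)

/-- The squared modulus of the sum is the Fourier transform of `diffReps G`, so by Parseval the
fourth moment is q times the energy. -/
theorem card_mul_norm_sum_addChar_pow_four_le (hG : IsUnitSubgroup G) {ψ : AddChar F ℂ}
    (hψ : ψ.IsPrimitive) {a : F} (ha : a ≠ 0) :
    #G * ‖∑ x ∈ G, ψ (a * x)‖ ^ 4 ≤ Fintype.card F * (∑ z, diffReps G z ^ 2 : ℕ) := by
  have h := card_mul_le_sum_of_invariant (G := G) (h := fun ξ ↦ ‖∑ x ∈ G, ψ (ξ * x)‖ ^ 4)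
    (fun _ ↦ by positivity) (fun g hg ξ ↦ by rw [sum_addChar_mul_invariant hG ψ hg]) ha
  have hP := sum_norm_sq_fourier hψ (fun z ↦ (diffReps G z : ℂ))
  have e : ∀ ξ, ∑ z, (diffReps G z : ℂ) * ψ (ξ * z) =
      (∑ x ∈ G, ψ (ξ * x)) * conj (∑ x ∈ G, ψ (ξ * x)) := by
    intro ξ
    rw [map_sum, sum_mul_sum, ← sum_product',
      ← sum_fiberwise_of_maps_to (t := univ) (g := fun p : F × F ↦ p.1 - p.2)
        (fun _ _ ↦ mem_univ _)]
    refine sum_congr rfl fun z _ ↦ ?_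
    rw [diffReps, card_eq_sum_ones, Nat.cast_sum, sum_mul]
    refine sum_congr rfl fun p hp ↦ ?_
    rw [← (mem_filter.1 hp).2, conj_addChar_apply, mul_sub, sub_eq_add_neg,
      AddChar.map_add_eq_mul]
    simp
  have e2 : ∀ ξ, ‖(∑ x ∈ G, ψ (ξ * x)) * conj (∑ x ∈ G, ψ (ξ * x))‖ ^ 2 =
      ‖∑ x ∈ G, ψ (ξ * x)‖ ^ 4 := by
    intro ξ
    rw [norm_mul, RCLike.norm_conj]; ring
  simp only [e, e2, Complex.norm_natCast] at hP
  rw [hP] at h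
  exact_mod_cast h

end CharacterSums

/-! ### Power residues, the canonical character and subfields -/

section PowerResidues

open Finset

variable {F : Type*} [Field F] [Fintype F] [DecidableEq F]

/-- The group of nonzero `n`-th powers. -/
def powerResidues (F : Type*) [Field F] [Fintype F] [DecidableEq F] (n : ℕ) : Finset F :=
  ({x | x ≠ 0} : Finset F).image (· ^ n)

theorem mem_powerResidues {n : ℕ} {y : F} :
    y ∈ powerResidues F n ↔ ∃ x : F, x ≠ 0 ∧ x ^ n = y := by
  simp [powerResidues]

theorem isUnitSubgroup_powerResidues (n : ℕ) : IsUnitSubgroup (powerResidues F n) where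
  one_mem := mem_powerResidues.2 ⟨1, one_ne_zero, one_pow n⟩
  zero_notMem h := by
    obtain ⟨x, hx, h⟩ := mem_powerResidues.1 h
    exact pow_ne_zero n hx h
  mul_mem a ha b hb := by
    obtain ⟨x, hx, rfl⟩ := mem_powerResidues.1 ha
    obtain ⟨y, hy, rfl⟩ := mem_powerResidues.1 hb
    exact mem_powerResidues.2 ⟨x * y, mul_ne_zero hx hy, mul_pow x y n⟩
  inv_mem a ha := by
    obtain ⟨x, hx, rfl⟩ := mem_powerResidues.1 ha
    exact mem_powerResidues.2 ⟨x⁻¹, inv_ne_zero hx, inv_pow x n⟩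

omit [Fintype F] [DecidableEq F] in
theorem card_le_of_forall_pow_eq_one {k : ℕ} (hk : 0 < k) {B : Finset F}
    (hB : ∀ x ∈ B, x ^ k = 1) : #B ≤ k := by
  have h : B.val ≤ Polynomial.nthRoots k (1 : F) := B.val_le_iff_val_subset.2 fun x hx ↦
    (Polynomial.mem_nthRoots hk).2 (hB x hx)
  exact (Multiset.card_le_card h).trans (Polynomial.card_nthRoots k 1)

theorem pow_eq_one_of_mem_powerResidues {n t : ℕ} (hnt : t * n = Fintype.card F - 1) {y : F}
    (hy : y ∈ powerResidues F n) : y ^ t = 1 := by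
  obtain ⟨x, hx, rfl⟩ := mem_powerResidues.1 hy
  rw [← pow_mul, mul_comm n t, hnt, FiniteField.pow_card_sub_one_eq_one x hx]

theorem card_fiber_pow {n : ℕ} {y : F} (hy : y ∈ powerResidues F n) :
    #{x ∈ ({x | x ≠ 0} : Finset F) | x ^ n = y} = #{x ∈ ({x | x ≠ 0} : Finset F) | x ^ n = 1} := by
  obtain ⟨u, hu, rfl⟩ := mem_powerResidues.1 hy
  refine card_nbij' (u⁻¹ * ·) (u * ·) ?_ ?_ ?_ ?_
  · intro x hx
    simp only [coe_filter, mem_filter, mem_univ, true_and, Set.mem_ofPred_eq] at hx ⊢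
    exact ⟨mul_ne_zero (inv_ne_zero hu) hx.1, by
      rw [mul_pow, hx.2, inv_pow, inv_mul_cancel₀ (pow_ne_zero n hu)]⟩
  · intro x hx
    simp only [coe_filter, mem_filter, mem_univ, true_and, Set.mem_ofPred_eq] at hx ⊢
    exact ⟨mul_ne_zero hu hx.1, by rw [mul_pow, hx.2, mul_one]⟩
  · intro x _; exact mul_inv_cancel_left₀ hu x
  · intro x _; exact inv_mul_cancel_left₀ hu x

/-- Counting roots of unity bounds the kernel by n and the image by t. Their product is q - 1 = tn,
so both bounds are attained. -/
theorem card_kernel_pow_and_card_powerResidues {n t : ℕ} (hnt : t * n = Fintype.card F - 1) :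
    #{x ∈ ({x | x ≠ 0} : Finset F) | x ^ n = 1} = n ∧ #(powerResidues F n) = t := by
  have hq : 0 < Fintype.card F - 1 := Nat.sub_pos_of_lt Fintype.one_lt_card
  have hn : 0 < n := Nat.pos_of_ne_zero fun h ↦ by simp [h] at hnt; omega
  have ht : 0 < t := Nat.pos_of_ne_zero fun h ↦ by simp [h] at hnt; omega
  have h1 : #{x ∈ ({x | x ≠ 0} : Finset F) | x ^ n = 1} ≤ n :=
    card_le_of_forall_pow_eq_one hn fun x hx ↦ (mem_filter.1 hx).2
  have h2 : #(powerResidues F n) ≤ t :=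
    card_le_of_forall_pow_eq_one ht fun x hx ↦ pow_eq_one_of_mem_powerResidues hnt hx
  have h3 : Fintype.card F - 1 = #(powerResidues F n) *
      #{x ∈ ({x | x ≠ 0} : Finset F) | x ^ n = 1} := by
    have e : #({x | x ≠ 0} : Finset F) = Fintype.card F - 1 := by
      rw [filter_ne', card_erase_of_mem (mem_univ _), card_univ]
    rw [← e, card_eq_sum_card_fiberwise (f := (· ^ n)) (t := powerResidues F n)
      (fun x hx ↦ mem_image_of_mem _ hx), sum_congr rfl fun y hy ↦ card_fiber_pow hy, sum_const,
      smul_eq_mul]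
  rw [← hnt] at h3
  constructor
  · refine le_antisymm h1 (Nat.le_of_mul_le_mul_left ?_ ht)
    rw [h3]; exact Nat.mul_le_mul_right _ h2
  · refine le_antisymm h2 (Nat.le_of_mul_le_mul_right ?_ hn)
    rw [h3]; exact Nat.mul_le_mul_left _ h1

theorem sum_pow_eq {n t : ℕ} (hnt : t * n = Fintype.card F - 1) (f : F → ℂ) :
    ∑ x, f (x ^ n) = f 0 + n * ∑ y ∈ powerResidues F n, f y := by
  have hq : 0 < Fintype.card F - 1 := Nat.sub_pos_of_lt Fintype.one_lt_card
  have hn : n ≠ 0 := fun h ↦ by simp [h] at hnt; omega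
  have h : ∑ x ∈ ({x | x ≠ 0} : Finset F), f (x ^ n) = n * ∑ y ∈ powerResidues F n, f y := by
    rw [← sum_fiberwise_of_maps_to (g := (· ^ n)) (t := powerResidues F n)
      (fun x hx ↦ mem_image_of_mem _ hx), mul_sum]
    refine sum_congr rfl fun y hy ↦ ?_
    rw [sum_congr rfl fun x hx ↦ by rw [(mem_filter.1 hx).2], sum_const, card_fiber_pow hy,
      (card_kernel_pow_and_card_powerResidues hnt).1, nsmul_eq_mul]
  rw [← h, filter_ne', ← add_sum_erase univ _ (mem_univ (0 : F)), zero_pow hn]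

theorem isPrimitive_canonicalChar (p : ℕ) [Fact p.Prime] (F : Type*) [Field F] [Fintype F]
    [Algebra (ZMod p) F] : (canonicalChar p F).IsPrimitive := by
  refine AddChar.IsPrimitive.of_ne_one fun h ↦ ?_
  obtain ⟨x, hx⟩ := Algebra.trace_surjective (ZMod p) F 1
  have h1 : ZMod.stdAddChar (N := p) (1 : ZMod p) = 1 := by
    rw [← hx]
    exact DFunLike.congr_fun h x
  rw [← AddChar.map_zero_eq_one (ZMod.stdAddChar (N := p))] at h1
  exact one_ne_zero (ZMod.injective_stdAddChar h1)

omit [DecidableEq F] in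
theorem exists_card_subfield_eq {p m : ℕ} [hp : Fact p.Prime] (hF : Fintype.card F = p ^ m)
    {K : Subfield F} (hK : K ≠ ⊤) : ∃ ν, 1 ≤ ν ∧ ν < m ∧ ν ∣ m ∧ Nat.card K = p ^ ν := by
  have hcard : Nat.card F = Nat.card K ^ Module.finrank K F := Module.natCard_eq_pow_finrank
  rw [Nat.card_eq_fintype_card, hF] at hcard
  have hpos : Module.finrank K F ≠ 0 := Module.finrank_pos.ne'
  obtain ⟨ν, -, hν⟩ := (Nat.dvd_prime_pow hp.out).1 (hcard ▸ dvd_pow_self (Nat.card K) hpos)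
  rw [hν, ← pow_mul] at hcard
  have hm := Nat.pow_right_injective hp.out.two_le hcard
  have hν0 : ν ≠ 0 := by
    rintro rfl
    have : 1 < Nat.card K := Finite.one_lt_card
    simp [hν] at this
  refine ⟨ν, Nat.one_le_iff_ne_zero.2 hν0, ?_, ⟨_, hm⟩, hν⟩
  refine lt_of_le_of_ne (hm ▸ Nat.le_mul_of_pos_right _ (Nat.pos_of_ne_zero hpos)) ?_
  rintro rfl
  refine hK (SetLike.coe_injective ?_)
  refine Set.eq_of_subset_of_ncard_le (Set.subset_univ _) ?_ (Set.toFinite _)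
  rw [Subfield.coe_top, Set.ncard_univ, Nat.card_eq_fintype_card, hF, ← hν]
  exact (Nat.card_coe_set_eq _).le

/-- The gcd condition bounds the intersections of the `n`-th powers with proper subfields. -/
theorem card_le_of_subfieldGcdCondition {p m n t : ℕ} [hp : Fact p.Prime]
    (hF : Fintype.card F = p ^ m) (hnt : t * n = Fintype.card F - 1) {C : ℝ}
    (hC : SubfieldGcdCondition C p m n) {K : Subfield F} (hK : K ≠ ⊤) {B : Finset F}
    (hB : B ⊆ powerResidues F n) (hBK : (B : Set F) ⊆ K) : (#B : ℝ) ≤ C * √(Nat.card K) := by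
  have hq : 0 < Fintype.card F - 1 := Nat.sub_pos_of_lt Fintype.one_lt_card
  have hn : 0 < n := Nat.pos_of_ne_zero fun h ↦ by simp [h] at hnt; omega
  have ht : 0 < t := Nat.pos_of_ne_zero fun h ↦ by simp [h] at hnt; omega
  obtain ⟨ν, hν1, hνm, hνd, hKcard⟩ := exists_card_subfield_eq hF hK
  have hdvd : p ^ ν - 1 ∣ p ^ m - 1 := by
    obtain ⟨k, rfl⟩ := hνd
    rw [pow_mul]
    simpa using Nat.sub_dvd_pow_sub_pow (p ^ ν) 1 k
  obtain ⟨k, hk⟩ := hdvd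
  have hpν : 1 < p ^ ν := Nat.one_lt_pow (by omega) hp.out.one_lt
  have hpν0 : 0 < p ^ ν - 1 := by omega
  have hkdiv : (p ^ m - 1) / (p ^ ν - 1) = k := by rw [hk, Nat.mul_div_cancel_left _ hpν0]
  have hcond := hC ν hν1 hνm hνd
  rw [hkdiv] at hcond
  -- Elements of B satisfy both x^t = 1 and x^(p^ν - 1) = 1, hence x^g = 1.
  set g := Nat.gcd t (p ^ ν - 1) with hg
  have hBg : #B ≤ g := by
    refine card_le_of_forall_pow_eq_one (Nat.gcd_pos_of_pos_left _ ht) fun x hx ↦ ?_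
    refine pow_gcd_eq_one.2 ⟨pow_eq_one_of_mem_powerResidues hnt (hB hx), ?_⟩
    have : Fintype K := Fintype.ofFinite K
    have hx0 : (⟨x, hBK hx⟩ : K) ≠ 0 := fun h ↦
      (isUnitSubgroup_powerResidues n).ne_zero (hB hx) (congrArg Subtype.val h)
    have h1 := FiniteField.pow_card_sub_one_eq_one _ hx0
    rw [← Nat.card_eq_fintype_card, hKcard] at h1
    exact congrArg Subtype.val h1
  -- Multiplying by n turns tn into q - 1 = (p^ν - 1)k, which exposes the gcd of the hypothesis.
  have hgn : g * n = (p ^ ν - 1) * Nat.gcd n k := by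
    rw [hg, ← Nat.gcd_mul_right, hnt, hF, hk, Nat.gcd_comm n k, ← Nat.gcd_mul_left]
  have hnR : (0 : ℝ) < n := by exact_mod_cast hn
  have hpR : (0 : ℝ) < p := by exact_mod_cast hp.out.pos
  have hsqrt : √(Nat.card K : ℝ) = (p : ℝ) ^ ((ν : ℝ) / 2) := by
    rw [hKcard, Nat.cast_pow, Real.sqrt_eq_rpow, ← Real.rpow_natCast, ← Real.rpow_mul hpR.le]
    congr 1; ring
  rw [hsqrt]
  set s := (p : ℝ) ^ ((ν : ℝ) / 2) with hs
  have hspos : 0 < s := Real.rpow_pos_of_pos hpR _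
  have hss : ((p ^ ν - 1 : ℕ) : ℝ) ≤ s * s := by
    rw [hs, ← Real.rpow_add hpR, add_halves, Real.rpow_natCast]
    exact_mod_cast Nat.sub_le _ _
  refine (Nat.cast_le.2 hBg).trans (le_of_mul_le_mul_right ?_ hnR)
  calc (g : ℝ) * n = ((p ^ ν - 1 : ℕ) : ℝ) * Nat.gcd n k := by exact_mod_cast hgn
    _ ≤ s * s * (C * (n / s)) := by gcongr
    _ = C * s * n := by field_simp

end PowerResidues

/-! ### Numerical exponents -/

section Exponents

/-- The bound n√q is good enough exactly when n ≤ q^(28/57), and 49/100 < 28/57. -/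
theorem mul_le_rpow_of_le_rpow {q n X : ℝ} (hq : 1 ≤ q) (hn : 1 ≤ n) (hX2 : X ^ 2 ≤ q)
    (hnq : n ≤ q ^ (49 / 100 : ℝ)) : n * X ≤ q ^ (92 / 128 : ℝ) * n ^ (71 / 128 : ℝ) := by
  have hq0 : 0 < q := by linarith
  have hn0 : 0 < n := by linarith
  have hXq : X ≤ q ^ (1 / 2 : ℝ) := by
    rw [← Real.sqrt_eq_rpow]
    exact Real.le_sqrt_of_sq_le hX2
  have h1 : n ^ (57 / 128 : ℝ) ≤ q ^ (28 / 128 : ℝ) := by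
    calc n ^ (57 / 128 : ℝ) ≤ (q ^ (49 / 100 : ℝ)) ^ (57 / 128 : ℝ) := by gcongr
      _ = q ^ (49 / 100 * (57 / 128) : ℝ) := by rw [← Real.rpow_mul hq0.le]
      _ ≤ q ^ (28 / 128 : ℝ) := Real.rpow_le_rpow_of_exponent_le hq (by norm_num)
  calc n * X ≤ n * q ^ (1 / 2 : ℝ) := by gcongr
    _ = n ^ (57 / 128 : ℝ) * n ^ (71 / 128 : ℝ) * q ^ (1 / 2 : ℝ) := by
        rw [← Real.rpow_add hn0]; norm_num
    _ ≤ q ^ (28 / 128 : ℝ) * n ^ (71 / 128 : ℝ) * q ^ (1 / 2 : ℝ) := by gcongr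
    _ = q ^ (28 / 128 : ℝ) * q ^ (1 / 2 : ℝ) * n ^ (71 / 128 : ℝ) := by ring
    _ = q ^ (92 / 128 : ℝ) * n ^ (71 / 128 : ℝ) := by rw [← Real.rpow_add hq0]; norm_num

theorem pow_nine_le_of_rpow_lt {q n τ : ℝ} (hq : 1 ≤ q) (hτ : 0 ≤ τ) (hτn : τ * n ≤ q)
    (hnq : q ^ (49 / 100 : ℝ) < n) : τ ^ 9 ≤ q ^ 5 := by
  have hq0 : 0 < q := by linarith
  have h1 : τ ≤ q ^ (51 / 100 : ℝ) := by
    refine le_of_mul_le_mul_right ?_ (Real.rpow_pos_of_pos hq0 (49 / 100))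
    calc τ * q ^ (49 / 100 : ℝ) ≤ τ * n := by gcongr
      _ ≤ q := hτn
      _ = q ^ (51 / 100 : ℝ) * q ^ (49 / 100 : ℝ) := by rw [← Real.rpow_add hq0]; norm_num
  calc τ ^ 9 ≤ (q ^ (51 / 100 : ℝ)) ^ 9 := by gcongr
    _ = q ^ (51 / 100 * 9 : ℝ) := by rw [← Real.rpow_natCast, ← Real.rpow_mul hq0.le]; norm_num
    _ ≤ q ^ (5 : ℝ) := Real.rpow_le_rpow_of_exponent_le hq (by norm_num)
    _ = q ^ 5 := by rw [← Real.rpow_natCast]; norm_num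

/-- Up to constants and L, the energy bound gives nX ≤ q^(77/104) n^(53/104), which wins once n ≥
q^(48/100). The gap up to 49/100 pays for L: after raising to the power 104, the loss q^(26/600) is
below the gain q^(3/64). -/
theorem mul_le_rpow_of_energy {q n τ X E L c : ℝ} (hq : 1 ≤ q) (hn : 1 ≤ n) (hτ : 0 < τ)
    (hτn : τ * n ≤ q) (hXE : τ * X ^ 4 ≤ q * E)
    (hc : 1 ≤ c) (hE : E ^ 26 ≤ c * L ^ 26 * τ ^ 77) (hL0 : 0 ≤ L)
    (hL : L ≤ 1000 * q ^ (1 / 600 : ℝ)) (hnq : q ^ (49 / 100 : ℝ) < n) :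
    n * X ≤ c * 1000 ^ 26 * (q ^ (92 / 128 : ℝ) * n ^ (71 / 128 : ℝ)) := by
  have hq0 : 0 < q := by linarith
  have hn0 : 0 < n := by linarith
  have h1 : X ^ 104 ≤ c * L ^ 26 * q ^ 26 * τ ^ 51 := by
    refine le_of_mul_le_mul_right ?_ (pow_pos hτ 26)
    calc X ^ 104 * τ ^ 26 = (τ * X ^ 4) ^ 26 := by ring
      _ ≤ (q * E) ^ 26 := by gcongr
      _ = q ^ 26 * E ^ 26 := by ring
      _ ≤ q ^ 26 * (c * L ^ 26 * τ ^ 77) := by gcongr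
      _ = _ := by ring
  have hL26 : L ^ 26 ≤ 1000 ^ 26 * q ^ (26 / 600 : ℝ) := by
    calc L ^ 26 ≤ (1000 * q ^ (1 / 600 : ℝ)) ^ 26 := by gcongr
      _ = 1000 ^ 26 * q ^ (26 / 600 : ℝ) := by
        rw [mul_pow, ← Real.rpow_natCast (q ^ (1 / 600 : ℝ)), ← Real.rpow_mul hq0.le]; norm_num
  have hn4 : q ^ (49 / 100 * (75 / 16) : ℝ) ≤ n ^ (75 / 16 : ℝ) := by
    rw [Real.rpow_mul hq0.le]
    gcongr
  have hY : (q ^ (92 / 128 : ℝ) * n ^ (71 / 128 : ℝ)) ^ 104 =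
      q ^ (299 / 4 : ℝ) * (n ^ 53 * n ^ (75 / 16 : ℝ)) := by
    rw [mul_pow, ← Real.rpow_natCast, ← Real.rpow_natCast (n ^ (71 / 128 : ℝ)),
      ← Real.rpow_natCast n, ← Real.rpow_mul hq0.le, ← Real.rpow_mul hn0.le, ← Real.rpow_add hn0]
    norm_num
  have hexp : q ^ (26 / 600 : ℝ) * q ^ 77 ≤
      q ^ (299 / 4 : ℝ) * q ^ (49 / 100 * (75 / 16) : ℝ) := by
    rw [← Real.rpow_natCast q 77, ← Real.rpow_add hq0, ← Real.rpow_add hq0]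
    exact Real.rpow_le_rpow_of_exponent_le hq (by norm_num)
  set K := c * 1000 ^ 26 with hK
  have hK1 : 1 ≤ K := by
    have : (1 : ℝ) ≤ 1000 ^ 26 := by norm_num
    nlinarith
  refine le_of_pow_le_pow_left₀ (n := 104) (by norm_num) (by positivity) ?_
  calc (n * X) ^ 104 = n ^ 104 * X ^ 104 := by ring
    _ ≤ n ^ 104 * (c * L ^ 26 * q ^ 26 * τ ^ 51) := by gcongr
    _ = c * L ^ 26 * q ^ 26 * n ^ 53 * (τ * n) ^ 51 := by ring
    _ ≤ c * (1000 ^ 26 * q ^ (26 / 600 : ℝ)) * q ^ 26 * n ^ 53 * q ^ 51 := by gcongr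
    _ = K * ((q ^ (26 / 600 : ℝ) * q ^ 77) * n ^ 53) := by rw [hK]; ring
    _ ≤ K * ((q ^ (299 / 4 : ℝ) * q ^ (49 / 100 * (75 / 16) : ℝ)) * n ^ 53) := by gcongr
    _ ≤ K * ((q ^ (299 / 4 : ℝ) * n ^ (75 / 16 : ℝ)) * n ^ 53) := by gcongr
    _ ≤ K ^ 104 * ((q ^ (299 / 4 : ℝ) * n ^ (75 / 16 : ℝ)) * n ^ 53) := by
        gcongr
        exact le_self_pow₀ hK1 (by norm_num)
    _ = (K * (q ^ (92 / 128 : ℝ) * n ^ (71 / 128 : ℝ))) ^ 104 := by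
        rw [mul_pow K, hY]; ring

theorem natLog_add_one_le {τ q : ℕ} (h : τ ≤ q) (hq : 1 ≤ q) :
    ((Nat.log 2 τ + 1 : ℕ) : ℝ) ≤ 1000 * (q : ℝ) ^ (1 / 600 : ℝ) := by
  have hqR : (1 : ℝ) ≤ q := by exact_mod_cast hq
  have h1 : (Nat.log 2 τ : ℝ) ≤ Real.logb 2 q :=
    (Nat.cast_le.2 (Nat.log_mono_right h)).trans (by exact_mod_cast Real.natLog_le_logb q 2)
  have h2 : Real.log q ≤ (q : ℝ) ^ (1 / 600 : ℝ) / (1 / 600) :=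
    Real.log_le_rpow_div (by linarith) (by norm_num)
  have h3 : (1 : ℝ) ≤ (q : ℝ) ^ (1 / 600 : ℝ) := Real.one_le_rpow hqR (by norm_num)
  have h4 : Real.logb 2 q ≤ 900 * (q : ℝ) ^ (1 / 600 : ℝ) := by
    rw [Real.logb, div_le_iff₀ (Real.log_pos one_lt_two)]
    nlinarith [Real.log_two_gt_d9]
  push_cast
  linarith

end Exponents

/-! ### The bound for the Gauss sums -/

theorem theorem6 :
    ∃ η : ℕ → ℝ, Tendsto η atTop (𝓝 0) ∧
      ∀ C : ℝ, 0 < C → ∃ K : ℝ, 0 < K ∧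
        ∀ (p m : ℕ) [Fact p.Prime] (F : Type*) [Field F] [Fintype F] [Algebra (ZMod p) F]
          (q : ℕ), q = p ^ m → Fintype.card F = q →
          ∀ n : ℕ, n ∣ q - 1 → SubfieldGcdCondition C p m n →
            ∀ a : F, a ≠ 0 →
              ‖gaussSumPow p n a‖ ≤
                K * ((q : ℝ) ^ ((91 : ℝ) / 128 + η q) * (n : ℝ) ^ ((73 : ℝ) / 128)
                  + (q : ℝ) ^ ((92 : ℝ) / 128 + η q) * (n : ℝ) ^ ((71 : ℝ) / 128)) := by
  refine ⟨fun _ ↦ 0, tendsto_const_nhds, fun C _ ↦ ?_⟩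
  set c : ℝ := (2 ^ 15 + 2 ^ 12 * C ^ 2) * 2 ^ 136 with hc
  have hc1 : 1 ≤ c := by
    have : 0 ≤ C ^ 2 := sq_nonneg C
    rw [hc]; norm_num; linarith
  have hK1 : 1 ≤ c * 1000 ^ 26 := by
    have : (1 : ℝ) ≤ 1000 ^ 26 := by norm_num
    nlinarith
  refine ⟨1 + c * 1000 ^ 26, by positivity, ?_⟩
  intro p m _ F _ _ _ q hqm hFq n hn hcond a ha
  classical
  simp only [add_zero]
  subst hFq
  obtain ⟨t, hnt⟩ := hn
  have hnt' : t * n = Fintype.card F - 1 := by rw [hnt, mul_comm]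
  have hq1 : 1 < Fintype.card F := Fintype.one_lt_card
  have hn1 : 1 ≤ n := Nat.one_le_iff_ne_zero.2 fun h ↦ by simp [h] at hnt; omega
  have ht1 : 1 ≤ t := Nat.one_le_iff_ne_zero.2 fun h ↦ by simp [h] at hnt; omega
  have hψ := isPrimitive_canonicalChar p F
  have hG := isUnitSubgroup_powerResidues (F := F) n
  obtain ⟨-, hGcard⟩ := card_kernel_pow_and_card_powerResidues hnt'
  set X := ‖∑ y ∈ powerResidues F n, canonicalChar p F (a * y)‖ with hX
  have hS : ‖gaussSumPow p n a‖ ≤ 1 + n * X := by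
    unfold gaussSumPow
    rw [sum_pow_eq hnt' fun y ↦ canonicalChar p F (a * y)]
    refine (norm_add_le _ _).trans ?_
    rw [AddChar.norm_apply, norm_mul, Complex.norm_natCast]
  have hqR : (1 : ℝ) ≤ Fintype.card F := by exact_mod_cast hq1.le
  have hnR : (1 : ℝ) ≤ n := by exact_mod_cast hn1
  have htR : (0 : ℝ) < t := by exact_mod_cast ht1
  have htn : (t : ℝ) * n ≤ Fintype.card F := by
    exact_mod_cast hnt'.le.trans (Nat.sub_le _ _)
  set Y := (Fintype.card F : ℝ) ^ (92 / 128 : ℝ) * (n : ℝ) ^ (71 / 128 : ℝ) with hY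
  have hY1 : 1 ≤ Y :=
    one_le_mul_of_one_le_of_one_le (Real.one_le_rpow hqR (by norm_num))
      (Real.one_le_rpow hnR (by norm_num))
  have hnX : n * X ≤ c * 1000 ^ 26 * Y := by
    rcases le_or_gt (n : ℝ) ((Fintype.card F : ℝ) ^ (49 / 100 : ℝ)) with hsmall | hlarge
    · refine (mul_le_rpow_of_le_rpow hqR hnR (norm_sum_addChar_sq_le hG hψ ha) hsmall).trans ?_
      exact le_mul_of_one_le_left (by linarith) hK1
    · have hq9 := pow_nine_le_of_rpow_lt hqR htR.le htn hlarge
      have hE := energy_pow_le hG (C := C)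
        (fun K hK B hB hBK ↦ card_le_of_subfieldGcdCondition hqm hnt' hcond hK hB hBK)
        (by rw [hGcard]; exact_mod_cast hq9)
      have h4 := card_mul_norm_sum_addChar_pow_four_le hG hψ ha
      rw [hGcard] at hE h4
      have htq : t ≤ Fintype.card F :=
        (Nat.le_mul_of_pos_right t hn1).trans (hnt'.le.trans (Nat.sub_le _ _))
      exact mul_le_rpow_of_energy hqR hnR htR htn h4 hc1 hE (Nat.cast_nonneg _)
        (natLog_add_one_le htq hq1.le) hlarge
  have hZ : 0 ≤ (Fintype.card F : ℝ) ^ (91 / 128 : ℝ) * (n : ℝ) ^ (73 / 128 : ℝ) := by positivity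
  calc ‖gaussSumPow p n a‖ ≤ 1 + n * X := hS
    _ ≤ Y + c * 1000 ^ 26 * Y := add_le_add hY1 hnX
    _ = (1 + c * 1000 ^ 26) * Y := by ring
    _ ≤ _ := by
      refine mul_le_mul_of_nonneg_left ?_ (by linarith)
      exact le_add_of_nonneg_left hZ
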